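/- **Conventions.** Let $(\Omega,\Sigma,\mu)$ be a complete, $\sigma$-finite, non-atomic measure space (non-atomic: every measurable set of positive measure contains a measurable subset of strictly smaller positive measure). Functions are real or complex valued (one fixed scalar field) and identified when equal a.e. A function is *locally integrable* if it is integrable over every measurable set of finite measure; $L_0$ is the space of locally integrable functions. A *Köthe function space* over $(\Omega,\Sigma,\mu)$ is a Banach space $X$ that is a linear subspace of $L_0$, such that $|f|\le|g|$ a.e. with $f$ measurable and $g\in X$ implies $f\in X$ and $\|f\|_X\le\|g\|_X$, and such that $\chi_\sigma\in X$ whenever $\mu(\sigma)<\infty$. It has the *Fatou property* if its closed unit ball is closed in $L_0$ for the topology of local convergence in measure. It is *1-disjointly homogeneous* if every normalized sequence with pairwise disjoint supports has a subsequence equivalent to the unit vector basis of $\ell_1$. For Köthe spaces $X,Y$ over $(\Omega,\Sigma,\mu)$ let $M(X,Y)$ be the space of all $\lambda\in L_0$ with $\lambda g\in Y$ for all $g\in X$, with norm $\|\lambda\|_{M(X,Y)}=\sup_{\|g\|_X=1}\|\lambda g\|_Y$, and let $M_\lambda\colon X\to Y$, $M_\lambda g=\lambda g$, for $\lambda \in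 M(X,Y)$. An element $f$ of $M(X,Y)$ is *order continuous* if $\|f_n\|\to0$ for all sequences $(f_n)$ in $M(X,Y)$ with $0\le f_n\le|f|$ and $f_n\downarrow0$ a.e.; $M(X,Y)_o$ is the set of order continuous elements. The element $f$ has *absolutely continuous norm* if $\|f\chi_{\sigma_n}\|\to0$ for every decreasing sequence $(\sigma_n)$ of measurable sets whose intersection has measure zero. A *simple function* is a finite linear combination of characteristic functions of sets of finite measure. A bounded operator is *weakly compact* if it maps bounded sets to relatively weakly compact sets, and the *weak essential norm* of $T\colon X\to Y$ is $\|T\|_w=\inf\{\|T-W\| : W\colon X\to Y \text{ bounded and weakly compact}\}$. **Theorem.** Let $X$ and $Y$ be two Köthe function spaces with the Fatou property over the same complete, $\sigma$-finite, non-atomic measure space $(\Omega,\Sigma,\mu)$. Suppose that $Y$ is 1-disjointly homogeneous, that every simple function in $M(X,Y)$ has absolutely continuous norm, and that $M(X,Y)$ contains $\chi_\sigma$ for every set $\sigma$ of finite measure that is contained (up to a null set) in the support of some element of $M(X,Y)$. Let $(\Omega_N)$ be a decomposition of $\Omega$ into countably many pairwise disjoint measurable sets of finite measure, and for $\lambda\in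 M(X,Y)$ put $$\mathcal U_n(\lambda)=\bigcup_{N\ge n}\Omega_N\cup\{\omega\in\operatorname{supp}\lambda : |\lambda(\omega)|>n\}.$$ Then, for every $\lambda\in M(X,Y)$, $$\|M_\lambda\colon X\to Y\|_w=\lim_{n\to\infty}\|\lambda\chi_{\mathcal U_n(\lambda)}\|_{M(X,Y)},$$ and $M_\lambda\colon X\to Y$ is weakly compact if and only if $\lambda\in M(X,Y)_o$. -/

import Mathlib

open MeasureTheory Filter Topology

noncomputable section

namespace Koethe

variable {𝕜 Ω : Type*} [RCLike 𝕜] [MeasurableSpace Ω] {μ : Measure Ω}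

/-- A measure is non-atomic if every measurable set of positive measure contains a measurable
subset of strictly smaller positive measure. (Mathlib's `NoAtoms` only says that points are
null sets.) -/
def IsNonatomic (μ : Measure Ω) : Prop :=
  ∀ s, MeasurableSet s → 0 < μ s → ∃ t, MeasurableSet t ∧ t ⊆ s ∧ 0 < μ t ∧ μ t < μ s

/-- Local integrability in the measure-theoretic sense: integrability over every measurable set
of finite measure. (Mathlib's `LocallyIntegrable` is a topological notion.) -/
def IsLocallyIntegrable (f : Ω →ₘ[μ] 𝕜) : Prop :=
  ∀ s, MeasurableSet s → μ s < ⊤ → IntegrableOn f s μ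

/-- The class of the characteristic function of a measurable set. -/
def charFn (𝕜 : Type*) [RCLike 𝕜] (μ : Measure Ω) (s : Set Ω) (hs : MeasurableSet s) :
    Ω →ₘ[μ] 𝕜 :=
  AEEqFun.mk (s.indicator fun _ => (1 : 𝕜)) (aestronglyMeasurable_const.indicator hs)

theorem coeFn_charFn (s : Set Ω) (hs : MeasurableSet s) :
    (charFn 𝕜 μ s hs : Ω → 𝕜) =ᵐ[μ] s.indicator fun _ => (1 : 𝕜) :=
  AEEqFun.coeFn_mk _ _

/-- Simple functions: finite linear combinations of characteristic functions of sets of finite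
measure. -/
def simpleFunctions (𝕜 : Type*) [RCLike 𝕜] (μ : Measure Ω) : Submodule 𝕜 (Ω →ₘ[μ] 𝕜) :=
  Submodule.span 𝕜 {f | ∃ (s : Set Ω) (hs : MeasurableSet s), μ s < ⊤ ∧ f = charFn 𝕜 μ s hs}

/-- A normed ideal of measurable functions: a linear space of classes of measurable functions
with a norm such that `|f| ≤ |g|` a.e. with `g` in the space implies that `f` is in the space and
`‖f‖ ≤ ‖g‖`. -/
structure NormedIdeal (𝕜 : Type*) {Ω : Type*} [RCLike 𝕜] [MeasurableSpace Ω] (μ : Measure Ω) where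
  carrier : Submodule 𝕜 (Ω →ₘ[μ] 𝕜)
  nrm : carrier → ℝ
  nrm_nonneg : ∀ f, 0 ≤ nrm f
  nrm_smul : ∀ (c : 𝕜) f, nrm (c • f) = ‖c‖ * nrm f
  nrm_add_le : ∀ f g, nrm (f + g) ≤ nrm f + nrm g
  nrm_eq_zero : ∀ f, nrm f = 0 → f = 0
  solid : ∀ (f : Ω →ₘ[μ] 𝕜) (g : carrier),
    (∀ᵐ ω ∂μ, ‖f ω‖ ≤ ‖(g : Ω →ₘ[μ] 𝕜) ω‖) → ∃ hf : f ∈ carrier, nrm ⟨f, hf⟩ ≤ nrm g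

instance (X : NormedIdeal 𝕜 μ) : Norm X.carrier := ⟨X.nrm⟩

theorem NormedIdeal.core (X : NormedIdeal 𝕜 μ) : NormedSpace.Core 𝕜 X.carrier where
  norm_nonneg := X.nrm_nonneg
  norm_smul := X.nrm_smul
  norm_triangle := X.nrm_add_le
  norm_eq_zero_iff f := by
    refine ⟨X.nrm_eq_zero f, ?_⟩
    rintro rfl
    have h := X.nrm_smul 0 0
    rw [zero_smul, norm_zero, zero_mul] at h
    exact h

instance (X : NormedIdeal 𝕜 μ) : NormedAddCommGroup X.carrier := NormedAddCommGroup.ofCore X.core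

instance (X : NormedIdeal 𝕜 μ) : NormedSpace 𝕜 X.carrier := NormedSpace.ofCore X.core

/-- A Köthe space: a Banach space that is a normed ideal, consists of locally integrable
functions and contains the characteristic functions of all sets of finite measure. -/
structure KoetheSpace (𝕜 : Type*) {Ω : Type*} [RCLike 𝕜] [MeasurableSpace Ω] (μ : Measure Ω) where
  toNormedIdeal : NormedIdeal 𝕜 μ
  complete : CompleteSpace toNormedIdeal.carrier
  locallyIntegrable : ∀ f ∈ toNormedIdeal.carrier, IsLocallyIntegrable f
  charFn_mem : ∀ s (hs : MeasurableSet s), μ s < ⊤ → charFn 𝕜 μ s hs ∈ toNormedIdeal.carrier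

/-- The linear space of functions underlying a Köthe space. -/
abbrev KoetheSpace.carrier (X : KoetheSpace 𝕜 μ) : Submodule 𝕜 (Ω →ₘ[μ] 𝕜) :=
  X.toNormedIdeal.carrier

namespace NormedIdeal

theorem mem_of_le (X : NormedIdeal 𝕜 μ) {f : Ω →ₘ[μ] 𝕜} (g : X.carrier)
    (h : ∀ᵐ ω ∂μ, ‖f ω‖ ≤ ‖(g : Ω →ₘ[μ] 𝕜) ω‖) : f ∈ X.carrier :=
  (X.solid f g h).1

theorem norm_le_of_le (X : NormedIdeal 𝕜 μ) (f g : X.carrier)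
    (h : ∀ᵐ ω ∂μ, ‖(f : Ω →ₘ[μ] 𝕜) ω‖ ≤ ‖(g : Ω →ₘ[μ] 𝕜) ω‖) : ‖f‖ ≤ ‖g‖ :=
  (X.solid f g h).2

/-- The function `f χ_s`, as an element of the space that contains `f`. -/
def cut (X : NormedIdeal 𝕜 μ) (f : X.carrier) (s : Set Ω) (hs : MeasurableSet s) : X.carrier :=
  ⟨(f : Ω →ₘ[μ] 𝕜) * charFn 𝕜 μ s hs, X.mem_of_le f (by
    filter_upwards [AEEqFun.coeFn_mul (f : Ω →ₘ[μ] 𝕜) (charFn 𝕜 μ s hs),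
      coeFn_charFn (𝕜 := 𝕜) (μ := μ) s hs] with ω h₁ h₂
    rw [h₁, Pi.mul_apply, h₂, norm_mul]
    by_cases hω : ω ∈ s <;> simp [hω])⟩

/-- The element `f` is order continuous: `‖u n‖ → 0` for every sequence `u` in the space with
`0 ≤ u n ≤ |f|` and `u n ↓ 0` almost everywhere. -/
def IsOrderContinuous (X : NormedIdeal 𝕜 μ) (f : X.carrier) : Prop :=
  ∀ u : ℕ → X.carrier,
    (∀ n, ∀ᵐ ω ∂μ, (u n : Ω →ₘ[μ] 𝕜) ω = ((‖(u n : Ω →ₘ[μ] 𝕜) ω‖ : ℝ) : 𝕜) ∧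
      ‖(u n : Ω →ₘ[μ] 𝕜) ω‖ ≤ ‖(f : Ω →ₘ[μ] 𝕜) ω‖ ∧
      ‖(u (n + 1) : Ω →ₘ[μ] 𝕜) ω‖ ≤ ‖(u n : Ω →ₘ[μ] 𝕜) ω‖) →
    (∀ᵐ ω ∂μ, Tendsto (fun n => (u n : Ω →ₘ[μ] 𝕜) ω) atTop (𝓝 0)) →
    Tendsto (fun n => ‖u n‖) atTop (𝓝 0)

/-- The element `f` has absolutely continuous norm: `‖f χ_{s n}‖ → 0` for every decreasing
sequence of measurable sets with intersection of measure zero. -/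
def HasAbsolutelyContinuousNorm (X : NormedIdeal 𝕜 μ) (f : X.carrier) : Prop :=
  ∀ (s : ℕ → Set Ω) (hs : ∀ n, MeasurableSet (s n)), Antitone s → μ (⋂ n, s n) = 0 →
    Tendsto (fun n => ‖X.cut f (s n) (hs n)‖) atTop (𝓝 0)

/-- The space contains the characteristic function of every set of finite measure that lies in
the support of one of its elements. -/
def ContainsCharFnsInSupport (X : NormedIdeal 𝕜 μ) : Prop :=
  ∀ (f : X.carrier) (s : Set Ω) (hs : MeasurableSet s), μ s < ⊤ →
    (∀ᵐ ω ∂μ, ω ∈ s → (f : Ω →ₘ[μ] 𝕜) ω ≠ 0) → charFn 𝕜 μ s hs ∈ X.carrier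

end NormedIdeal

namespace KoetheSpace

/-- The Fatou property: the closed unit ball is closed in the space of locally integrable
functions with the topology of local convergence in measure. The measure being σ-finite, this
topology is metrizable, and closedness is expressed by sequences. -/
def HasFatouProperty (X : KoetheSpace 𝕜 μ) : Prop :=
  ∀ (u : ℕ → X.carrier) (f : Ω →ₘ[μ] 𝕜), (∀ n, ‖u n‖ ≤ 1) → IsLocallyIntegrable f →
    (∀ s, MeasurableSet s → μ s < ⊤ →
      TendstoInMeasure (μ.restrict s) (fun n => (u n : Ω →ₘ[μ] 𝕜)) atTop f) →
    ∃ hf : f ∈ X.carrier, ‖(⟨f, hf⟩ : X.carrier)‖ ≤ 1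

/-- 1-disjoint homogeneity: every normalized disjoint sequence has a subsequence equivalent to
the unit vector basis of `ℓ₁`. -/
def IsOneDisjointlyHomogeneous (X : KoetheSpace 𝕜 μ) : Prop :=
  ∀ u : ℕ → X.carrier, (∀ n, ‖u n‖ = 1) →
    (∀ i j, i ≠ j → ∀ᵐ ω ∂μ, (u i : Ω →ₘ[μ] 𝕜) ω = 0 ∨ (u j : Ω →ₘ[μ] 𝕜) ω = 0) →
    ∃ φ : ℕ → ℕ, StrictMono φ ∧ ∃ c C : ℝ, 0 < c ∧ 0 < C ∧
      ∀ (F : Finset ℕ) (a : ℕ → 𝕜),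
        c * ∑ k ∈ F, ‖a k‖ ≤ ‖∑ k ∈ F, a k • u (φ k)‖ ∧
        ‖∑ k ∈ F, a k • u (φ k)‖ ≤ C * ∑ k ∈ F, ‖a k‖

end KoetheSpace

section Multipliers

theorem smul_mul' (c : 𝕜) (f g : Ω →ₘ[μ] 𝕜) : (c • f) * g = c • (f * g) := by
  apply AEEqFun.ext
  filter_upwards [AEEqFun.coeFn_mul (c • f) g, AEEqFun.coeFn_smul c (f * g),
    AEEqFun.coeFn_smul c f, AEEqFun.coeFn_mul f g] with ω a b d e
  rw [a, b, Pi.mul_apply, Pi.smul_apply, d, e, Pi.smul_apply, Pi.mul_apply, smul_mul_assoc]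

/-- The linear space of pointwise multipliers from `X` to `Y`. Its elements are automatically
locally integrable, since `f χ_s ∈ Y` for every set `s` of finite measure. -/
def multipliers (X Y : KoetheSpace 𝕜 μ) : Submodule 𝕜 (Ω →ₘ[μ] 𝕜) where
  carrier := {f | ∀ g ∈ X.carrier, f * g ∈ Y.carrier}
  add_mem' {f₁ f₂} h₁ h₂ g hg := by
    have : (f₁ + f₂) * g = f₁ * g + f₂ * g := by
      apply AEEqFun.ext
      filter_upwards [AEEqFun.coeFn_mul (f₁ + f₂) g, AEEqFun.coeFn_add (f₁ * g) (f₂ * g),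
        AEEqFun.coeFn_mul f₁ g, AEEqFun.coeFn_mul f₂ g, AEEqFun.coeFn_add f₁ f₂]
        with ω a b c d e
      rw [a, b, Pi.mul_apply, Pi.add_apply, c, d, e, Pi.add_apply, Pi.mul_apply, Pi.mul_apply,
        add_mul]
    rw [this]
    exact Y.carrier.add_mem (h₁ g hg) (h₂ g hg)
  zero_mem' g hg := by
    have : (0 : Ω →ₘ[μ] 𝕜) * g = 0 := by
      apply AEEqFun.ext
      filter_upwards [AEEqFun.coeFn_mul (0 : Ω →ₘ[μ] 𝕜) g,
        AEEqFun.coeFn_zero (μ := μ) (β := 𝕜)] with ω a b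
      rw [a, Pi.mul_apply, b, Pi.zero_apply, zero_mul]
    rw [this]
    exact Y.carrier.zero_mem
  smul_mem' c f h g hg := by
    rw [smul_mul']
    exact Y.carrier.smul_mem c (h g hg)

variable (X Y : KoetheSpace 𝕜 μ)

/-- Multiplication by the multiplier `f`, as a linear map. -/
def mulLin (f : multipliers X Y) : X.carrier →ₗ[𝕜] Y.carrier where
  toFun g := ⟨(f : Ω →ₘ[μ] 𝕜) * g, f.2 g g.2⟩
  map_add' g₁ g₂ := by
    apply Subtype.ext
    apply AEEqFun.ext
    change _ =ᵐ[μ] ((f : Ω →ₘ[μ] 𝕜) * (g₁ : Ω →ₘ[μ] 𝕜) + (f : Ω →ₘ[μ] 𝕜) * (g₂ : Ω →ₘ[μ] 𝕜) :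
      Ω →ₘ[μ] 𝕜)
    filter_upwards [AEEqFun.coeFn_mul (f : Ω →ₘ[μ] 𝕜) (g₁ + g₂ : X.carrier),
      AEEqFun.coeFn_add ((f : Ω →ₘ[μ] 𝕜) * (g₁ : Ω →ₘ[μ] 𝕜))
        ((f : Ω →ₘ[μ] 𝕜) * (g₂ : Ω →ₘ[μ] 𝕜)),
      AEEqFun.coeFn_mul (f : Ω →ₘ[μ] 𝕜) (g₁ : Ω →ₘ[μ] 𝕜),
      AEEqFun.coeFn_mul (f : Ω →ₘ[μ] 𝕜) (g₂ : Ω →ₘ[μ] 𝕜),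
      AEEqFun.coeFn_add (g₁ : Ω →ₘ[μ] 𝕜) g₂] with ω a b c d e
    rw [a, b, Pi.mul_apply, Pi.add_apply, c, d, Pi.mul_apply, Pi.mul_apply, ← mul_add]
    congr 1
  map_smul' c g := by
    apply Subtype.ext
    change (f : Ω →ₘ[μ] 𝕜) * (c • (g : Ω →ₘ[μ] 𝕜)) = c • ((f : Ω →ₘ[μ] 𝕜) * (g : Ω →ₘ[μ] 𝕜))
    rw [mul_comm, smul_mul', mul_comm]

theorem mulLin_coeFn (f : multipliers X Y) (g : X.carrier) :
    ((mulLin X Y f g : Ω →ₘ[μ] 𝕜) : Ω → 𝕜) =ᵐ[μ]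
      fun ω => (f : Ω →ₘ[μ] 𝕜) ω * (g : Ω →ₘ[μ] 𝕜) ω :=
  AEEqFun.coeFn_mul _ _

/-- If `u n → v` in norm and eventually `Re k ≤ Re (u n)` a.e., then `Re k ≤ Re v` a.e. -/
theorem re_le_of_tendsto (X : NormedIdeal 𝕜 μ) (u : ℕ → X.carrier) (v : X.carrier)
    (k : Ω →ₘ[μ] 𝕜) (hu : Tendsto u atTop (𝓝 v))
    (hk : ∀ᶠ n in atTop, ∀ᵐ ω ∂μ, RCLike.re (k ω) ≤ RCLike.re ((u n : Ω →ₘ[μ] 𝕜) ω)) :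
    ∀ᵐ ω ∂μ, RCLike.re (k ω) ≤ RCLike.re ((v : Ω →ₘ[μ] 𝕜) ω) := by
  let w : Ω →ₘ[μ] 𝕜 := AEEqFun.mk
    (fun ω => ((max (RCLike.re (k ω) - RCLike.re ((v : Ω →ₘ[μ] 𝕜) ω)) 0 : ℝ) : 𝕜)) (by
      have h1 := RCLike.continuous_re.comp_aestronglyMeasurable k.aestronglyMeasurable
      have h2 := RCLike.continuous_re.comp_aestronglyMeasurable
        (v : Ω →ₘ[μ] 𝕜).aestronglyMeasurable
      exact RCLike.continuous_ofReal.comp_aestronglyMeasurable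
        ((h1.sub h2).sup aestronglyMeasurable_const))
  have hw : (w : Ω → 𝕜) =ᵐ[μ]
      fun ω => ((max (RCLike.re (k ω) - RCLike.re ((v : Ω →ₘ[μ] 𝕜) ω)) 0 : ℝ) : 𝕜) :=
    AEEqFun.coeFn_mk _ _
  have key : ∀ n, (∀ᵐ ω ∂μ, RCLike.re (k ω) ≤ RCLike.re ((u n : Ω →ₘ[μ] 𝕜) ω)) →
      ∀ᵐ ω ∂μ, ‖w ω‖ ≤ ‖((u n - v : X.carrier) : Ω →ₘ[μ] 𝕜) ω‖ := by
    intro n hn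
    filter_upwards [hn, hw, AEEqFun.coeFn_sub (u n : Ω →ₘ[μ] 𝕜) v] with ω h1 h2 h3
    have h4 : ((u n - v : X.carrier) : Ω →ₘ[μ] 𝕜) ω
        = (u n : Ω →ₘ[μ] 𝕜) ω - (v : Ω →ₘ[μ] 𝕜) ω := h3
    rw [h2, h4, RCLike.norm_ofReal, abs_of_nonneg (le_max_right _ _)]
    refine max_le ?_ (norm_nonneg _)
    refine le_trans ?_ (RCLike.re_le_norm _)
    rw [map_sub]
    linarith
  obtain ⟨N, hN⟩ := hk.exists
  have hwX : w ∈ X.carrier := X.mem_of_le _ (key N hN)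
  have h0 : ‖(⟨w, hwX⟩ : X.carrier)‖ ≤ 0 := by
    have ht : Tendsto (fun n => ‖u n - v‖) atTop (𝓝 0) := by
      have := tendsto_iff_norm_sub_tendsto_zero.1 hu
      exact this
    refine ge_of_tendsto ht ?_
    filter_upwards [hk] with n hn
    exact X.norm_le_of_le _ _ (key n hn)
  have hz : (⟨w, hwX⟩ : X.carrier) = 0 := norm_le_zero_iff.1 h0
  have hz' : w = 0 := congrArg Subtype.val hz
  have hz'' : (w : Ω → 𝕜) =ᵐ[μ] 0 := by rw [hz']; exact AEEqFun.coeFn_zero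
  filter_upwards [hw, hz''] with ω h1 h2
  rw [h1, Pi.zero_apply] at h2
  have h3 : max (RCLike.re (k ω) - RCLike.re ((v : Ω →ₘ[μ] 𝕜) ω)) 0 = 0 := by
    exact_mod_cast h2
  have := le_max_left (RCLike.re (k ω) - RCLike.re ((v : Ω →ₘ[μ] 𝕜) ω)) 0
  linarith

/-- The modulus of an element. -/
theorem exists_abs (X : NormedIdeal 𝕜 μ) (g : X.carrier) :
    ∃ h : X.carrier, (((h : Ω →ₘ[μ] 𝕜) : Ω → 𝕜) =ᵐ[μ]
      fun ω => ((‖(g : Ω →ₘ[μ] 𝕜) ω‖ : ℝ) : 𝕜)) ∧ ‖h‖ = ‖g‖ := by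
  let w : Ω →ₘ[μ] 𝕜 := AEEqFun.mk (fun ω => ((‖(g : Ω →ₘ[μ] 𝕜) ω‖ : ℝ) : 𝕜))
    (RCLike.continuous_ofReal.comp_aestronglyMeasurable
      (g : Ω →ₘ[μ] 𝕜).aestronglyMeasurable.norm)
  have hw : (w : Ω → 𝕜) =ᵐ[μ] fun ω => ((‖(g : Ω →ₘ[μ] 𝕜) ω‖ : ℝ) : 𝕜) := AEEqFun.coeFn_mk _ _
  have he : ∀ᵐ ω ∂μ, ‖w ω‖ = ‖(g : Ω →ₘ[μ] 𝕜) ω‖ := by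
    filter_upwards [hw] with ω h
    rw [h, RCLike.norm_ofReal, abs_norm]
  have hwX : w ∈ X.carrier := X.mem_of_le g (he.mono fun _ h => h.le)
  exact ⟨⟨w, hwX⟩, hw, le_antisymm (X.norm_le_of_le _ _ (he.mono fun _ h => h.le))
    (X.norm_le_of_le _ _ (he.mono fun _ h => h.ge))⟩

/-- Multiplication operators between Köthe spaces are bounded. -/
theorem mulLin_bound (f : multipliers X Y) : ∃ C : ℝ, ∀ g, ‖mulLin X Y f g‖ ≤ C * ‖g‖ := by
  by_contra hcon
  push Not at hcon
  choose g hg using fun n : ℕ => hcon ((4 : ℝ) ^ n)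
  have hgpos : ∀ n, 0 < ‖g n‖ := by
    intro n
    rw [norm_pos_iff]
    intro h0
    have := hg n
    rw [h0, map_zero, norm_zero, norm_zero, mul_zero] at this
    exact lt_irrefl _ this
  choose a ha ha' using fun n => exists_abs X.toNormedIdeal (g n)
  let c : ℕ → ℝ := fun n => (1 / 2) ^ n / ‖g n‖
  have hc : ∀ n, 0 < c n := fun n => div_pos (by positivity) (hgpos n)
  let h : ℕ → X.carrier := fun n => ((c n : ℝ) : 𝕜) • a n
  have hh : ∀ n, (((h n : X.carrier) : Ω →ₘ[μ] 𝕜) : Ω → 𝕜) =ᵐ[μ]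
      fun ω => ((c n * ‖(g n : Ω →ₘ[μ] 𝕜) ω‖ : ℝ) : 𝕜) := by
    intro n
    filter_upwards [ha n, AEEqFun.coeFn_smul ((c n : ℝ) : 𝕜) (a n : Ω →ₘ[μ] 𝕜)] with ω h1 h2
    change (((c n : ℝ) : 𝕜) • (a n : Ω →ₘ[μ] 𝕜) : Ω →ₘ[μ] 𝕜) ω = _
    rw [h2, Pi.smul_apply, h1, smul_eq_mul, RCLike.ofReal_mul]
  have hnorm : ∀ n, ‖h n‖ = (1 / 2) ^ n := by
    intro n
    rw [norm_smul, RCLike.norm_ofReal, abs_of_pos (hc n), ha' n]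
    exact div_mul_cancel₀ _ (hgpos n).ne'
  have : CompleteSpace X.carrier := X.complete
  have hsum : Summable h := by
    apply Summable.of_norm
    simp only [hnorm]
    exact summable_geometric_two
  have hle : ∀ n, ∀ᵐ ω ∂μ, RCLike.re ((h n : Ω →ₘ[μ] 𝕜) ω) ≤
      RCLike.re (((∑' n, h n : X.carrier) : Ω →ₘ[μ] 𝕜) ω) := by
    intro n
    refine re_le_of_tendsto X.toNormedIdeal _ _ _ hsum.hasSum.tendsto_sum_nat ?_
    filter_upwards [eventually_gt_atTop n] with m hm
    have hpos : ∀ᵐ ω ∂μ, ∀ i, 0 ≤ RCLike.re ((h i : Ω →ₘ[μ] 𝕜) ω) := by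
      rw [ae_all_iff]
      intro i
      filter_upwards [hh i] with ω h1
      rw [h1, RCLike.ofReal_re]
      exact mul_nonneg (hc i).le (norm_nonneg _)
    have hfs : ∀ F : Finset ℕ, ∀ᵐ ω ∂μ, ((∑ i ∈ F, h i : X.carrier) : Ω →ₘ[μ] 𝕜) ω
        = ∑ i ∈ F, (h i : Ω →ₘ[μ] 𝕜) ω := by
      intro F
      induction F using Finset.induction_on with
      | empty =>
        filter_upwards [AEEqFun.coeFn_zero (μ := μ) (β := 𝕜)] with ω h1
        simpa using h1
      | insert i F hi ih =>
        filter_upwards [ih, AEEqFun.coeFn_add (h i : Ω →ₘ[μ] 𝕜) (∑ i ∈ F, h i : X.carrier)]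
          with ω h1 h2
        rw [Finset.sum_insert hi, Finset.sum_insert hi, ← h1]
        exact h2
    filter_upwards [hpos, hfs (Finset.range m)] with ω h1 h2
    rw [h2, map_sum]
    exact Finset.single_le_sum (f := fun i => RCLike.re ((h i : Ω →ₘ[μ] 𝕜) ω))
      (fun i _ => h1 i) (Finset.mem_range.2 hm)
  have hbig : ∀ n : ℕ, (2 : ℝ) ^ n ≤ ‖mulLin X Y f (∑' n, h n)‖ := by
    intro n
    have h1 : ‖mulLin X Y f (((c n : ℝ) : 𝕜) • g n)‖ ≤ ‖mulLin X Y f (∑' n, h n)‖ := by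
      apply Y.toNormedIdeal.norm_le_of_le
      filter_upwards [mulLin_coeFn X Y f (((c n : ℝ) : 𝕜) • g n),
        mulLin_coeFn X Y f (∑' n, h n), hle n, hh n,
        AEEqFun.coeFn_smul ((c n : ℝ) : 𝕜) (g n : Ω →ₘ[μ] 𝕜)] with ω e1 e2 e3 e4 e5
      have e6 : ((((c n : ℝ) : 𝕜) • g n : X.carrier) : Ω →ₘ[μ] 𝕜) ω
          = ((c n : ℝ) : 𝕜) * (g n : Ω →ₘ[μ] 𝕜) ω := e5
      rw [e1, e2, norm_mul, norm_mul, e6, norm_mul, RCLike.norm_ofReal, abs_of_pos (hc n)]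
      rw [e4, RCLike.ofReal_re] at e3
      exact mul_le_mul_of_nonneg_left (e3.trans (RCLike.re_le_norm _)) (norm_nonneg _)
    refine le_trans ?_ h1
    rw [map_smul, norm_smul, RCLike.norm_ofReal, abs_of_pos (hc n)]
    calc (2 : ℝ) ^ n = c n * (4 ^ n * ‖g n‖) := by
          have : (4 : ℝ) ^ n = 2 ^ n * 2 ^ n := by rw [← mul_pow]; norm_num
          simp only [c, this]
          have := (hgpos n).ne'
          field_simp
          rw [one_div, inv_pow]
          field_simp
      _ ≤ _ := mul_le_mul_of_nonneg_left (hg n).le (hc n).le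
  obtain ⟨n, hn⟩ := pow_unbounded_of_one_lt ‖mulLin X Y f (∑' n, h n)‖ (one_lt_two (α := ℝ))
  exact absurd (hbig n) (not_le.2 hn)

/-- The multiplication operator `M_f : X → Y`, `g ↦ f g`, as a bounded operator. -/
def mulOp (f : multipliers X Y) : X.carrier →L[𝕜] Y.carrier :=
  (mulLin X Y f).mkContinuousOfExistsBound (mulLin_bound X Y f)

/-- The norm of a multiplier: the supremum of `‖f g‖` over the unit sphere of `X`. -/
def multiplierNorm (f : multipliers X Y) : ℝ :=
  sSup {r | ∃ g : X.carrier, ‖g‖ = 1 ∧ r = ‖mulOp X Y f g‖}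

theorem multiplierNorm_bddAbove (f : multipliers X Y) :
    BddAbove {r | ∃ g : X.carrier, ‖g‖ = 1 ∧ r = ‖mulOp X Y f g‖} := by
  refine ⟨‖mulOp X Y f‖, ?_⟩
  rintro r ⟨g, hg, rfl⟩
  simpa [hg] using (mulOp X Y f).le_opNorm g

theorem multiplierNorm_nonneg (f : multipliers X Y) : 0 ≤ multiplierNorm X Y f := by
  apply Real.sSup_nonneg
  rintro r ⟨g, _, rfl⟩
  exact norm_nonneg _

theorem le_multiplierNorm (f : multipliers X Y) (g : X.carrier) :
    ‖mulOp X Y f g‖ ≤ multiplierNorm X Y f * ‖g‖ := by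
  rcases eq_or_ne g 0 with rfl | hg
  · simp
  have hp : 0 < ‖g‖ := norm_pos_iff.2 hg
  have h := le_csSup (multiplierNorm_bddAbove X Y f)
    ⟨((‖g‖⁻¹ : ℝ) : 𝕜) • g, by
      rw [norm_smul, RCLike.norm_ofReal, abs_of_pos (inv_pos.2 hp), inv_mul_cancel₀ hp.ne'], rfl⟩
  rw [map_smul, norm_smul, RCLike.norm_ofReal, abs_of_pos (inv_pos.2 hp)] at h
  rw [← div_le_iff₀ hp, div_eq_inv_mul]
  exact h

theorem multiplierNorm_le (f : multipliers X Y) {C : ℝ} (hC : 0 ≤ C)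
    (h : ∀ g, ‖mulOp X Y f g‖ ≤ C * ‖g‖) : multiplierNorm X Y f ≤ C := by
  apply Real.sSup_le _ hC
  rintro r ⟨g, hg, rfl⟩
  simpa [hg] using h g

theorem multiplierNorm_eq_opNorm (f : multipliers X Y) :
    multiplierNorm X Y f = ‖mulOp X Y f‖ :=
  le_antisymm (multiplierNorm_le X Y f (norm_nonneg _) (mulOp X Y f).le_opNorm)
    ((mulOp X Y f).opNorm_le_bound (multiplierNorm_nonneg X Y f) (le_multiplierNorm X Y f))

theorem mulOp_add (f₁ f₂ : multipliers X Y) :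
    mulOp X Y (f₁ + f₂) = mulOp X Y f₁ + mulOp X Y f₂ := by
  ext1 g
  apply Subtype.ext
  apply AEEqFun.ext
  change (((f₁ : Ω →ₘ[μ] 𝕜) + (f₂ : Ω →ₘ[μ] 𝕜)) * (g : Ω →ₘ[μ] 𝕜) : Ω →ₘ[μ] 𝕜) =ᵐ[μ]
    ((f₁ : Ω →ₘ[μ] 𝕜) * (g : Ω →ₘ[μ] 𝕜) + (f₂ : Ω →ₘ[μ] 𝕜) * (g : Ω →ₘ[μ] 𝕜) : Ω →ₘ[μ] 𝕜)
  filter_upwards [AEEqFun.coeFn_mul ((f₁ : Ω →ₘ[μ] 𝕜) + (f₂ : Ω →ₘ[μ] 𝕜)) (g : Ω →ₘ[μ] 𝕜),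
    AEEqFun.coeFn_add ((f₁ : Ω →ₘ[μ] 𝕜) * (g : Ω →ₘ[μ] 𝕜)) ((f₂ : Ω →ₘ[μ] 𝕜) * (g : Ω →ₘ[μ] 𝕜)),
    AEEqFun.coeFn_mul (f₁ : Ω →ₘ[μ] 𝕜) (g : Ω →ₘ[μ] 𝕜),
    AEEqFun.coeFn_mul (f₂ : Ω →ₘ[μ] 𝕜) (g : Ω →ₘ[μ] 𝕜),
    AEEqFun.coeFn_add (f₁ : Ω →ₘ[μ] 𝕜) (f₂ : Ω →ₘ[μ] 𝕜)] with ω a b c d e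
  rw [a, b, Pi.mul_apply, Pi.add_apply, c, d, e, Pi.add_apply, Pi.mul_apply, Pi.mul_apply, add_mul]

theorem mulOp_smul (c : 𝕜) (f : multipliers X Y) : mulOp X Y (c • f) = c • mulOp X Y f := by
  ext1 g
  apply Subtype.ext
  change (c • (f : Ω →ₘ[μ] 𝕜)) * (g : Ω →ₘ[μ] 𝕜) = c • ((f : Ω →ₘ[μ] 𝕜) * (g : Ω →ₘ[μ] 𝕜))
  rw [smul_mul']

theorem mulOp_eq_zero [SigmaFinite μ] (f : multipliers X Y) (h : mulOp X Y f = 0) : f = 0 := by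
  apply Subtype.ext
  apply AEEqFun.ext
  have hz : ∀ n, ∀ᵐ ω ∂μ, ω ∈ spanningSets μ n → (f : Ω →ₘ[μ] 𝕜) ω = 0 := by
    intro n
    have hs := measurableSet_spanningSets μ n
    let g : X.carrier := ⟨charFn 𝕜 μ _ hs, X.charFn_mem _ hs (measure_spanningSets_lt_top μ n)⟩
    have h1 : mulOp X Y f g = 0 := by rw [h]; rfl
    have h2 : (f : Ω →ₘ[μ] 𝕜) * charFn 𝕜 μ _ hs = 0 := congrArg Subtype.val h1
    have h3 := AEEqFun.coeFn_mul (f : Ω →ₘ[μ] 𝕜) (charFn 𝕜 μ _ hs)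
    rw [h2] at h3
    filter_upwards [h3, AEEqFun.coeFn_zero (μ := μ) (β := 𝕜),
      coeFn_charFn (𝕜 := 𝕜) (μ := μ) _ hs] with ω a b c hω
    rw [b, Pi.mul_apply, c, Set.indicator_of_mem hω, mul_one] at a
    exact a.symm
  have hz' := ae_all_iff.2 hz
  change _ =ᵐ[μ] ((0 : Ω →ₘ[μ] 𝕜) : Ω → 𝕜)
  filter_upwards [hz', AEEqFun.coeFn_zero (μ := μ) (β := 𝕜)] with ω a b
  rw [b]
  exact a (spanningSetsIndex μ ω) (mem_spanningSetsIndex μ ω)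

/-- The space `M(X, Y)` of pointwise multipliers with the norm
`‖f‖ = sup {‖f g‖ | ‖g‖ = 1}`. -/
def multiplierSpace [SigmaFinite μ] (X Y : KoetheSpace 𝕜 μ) : NormedIdeal 𝕜 μ where
  carrier := multipliers X Y
  nrm := multiplierNorm X Y
  nrm_nonneg := multiplierNorm_nonneg X Y
  nrm_smul c f := by
    rw [multiplierNorm_eq_opNorm, multiplierNorm_eq_opNorm, mulOp_smul, norm_smul]
  nrm_add_le f g := by
    rw [multiplierNorm_eq_opNorm, multiplierNorm_eq_opNorm, multiplierNorm_eq_opNorm, mulOp_add]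
    exact norm_add_le _ _
  nrm_eq_zero f h := by
    rw [multiplierNorm_eq_opNorm, norm_eq_zero] at h
    exact mulOp_eq_zero X Y f h
  solid f g h := by
    have key : ∀ k : Ω →ₘ[μ] 𝕜, ∀ᵐ ω ∂μ,
        ‖(f * k : Ω →ₘ[μ] 𝕜) ω‖ ≤ ‖((g : Ω →ₘ[μ] 𝕜) * k : Ω →ₘ[μ] 𝕜) ω‖ := by
      intro k
      filter_upwards [h, AEEqFun.coeFn_mul f k, AEEqFun.coeFn_mul (g : Ω →ₘ[μ] 𝕜) k] with ω a b c
      rw [b, c, Pi.mul_apply, Pi.mul_apply, norm_mul, norm_mul]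
      exact mul_le_mul_of_nonneg_right a (norm_nonneg _)
    have hf : f ∈ multipliers X Y := fun k hk =>
      Y.toNormedIdeal.mem_of_le ⟨(g : Ω →ₘ[μ] 𝕜) * k, g.2 k hk⟩ (key k)
    refine ⟨hf, multiplierNorm_le X Y _ (multiplierNorm_nonneg X Y g) fun k => ?_⟩
    exact (Y.toNormedIdeal.norm_le_of_le _ _ (key k)).trans (le_multiplierNorm X Y g k)

end Multipliers

section WeakCompactness

variable {E F : Type*} [NormedAddCommGroup E] [NormedSpace 𝕜 E] [NormedAddCommGroup F]
  [NormedSpace 𝕜 F]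

/-- A bounded operator is weakly compact if it takes bounded sets to relatively weakly compact
sets. -/
def IsWeaklyCompactOperator (T : E →L[𝕜] F) : Prop :=
  ∀ B : Set E, Bornology.IsBounded B → IsCompact (closure (toWeakSpace 𝕜 F '' (T '' B)))

/-- The weak essential norm: the distance to the weakly compact operators in operator norm. -/
def weakEssentialNorm (T : E →L[𝕜] F) : ℝ :=
  sInf {r | ∃ W : E →L[𝕜] F, IsWeaklyCompactOperator W ∧ r = ‖T - W‖}

end WeakCompactness

/-- A decomposition of the measure space into pairwise disjoint measurable sets of finite
measure. -/
structure FiniteDecomposition (μ : Measure Ω) where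
  piece : ℕ → Set Ω
  measurableSet_piece : ∀ n, MeasurableSet (piece n)
  measure_piece_lt_top : ∀ n, μ (piece n) < ⊤
  disjoint_piece : Pairwise fun i j => Disjoint (piece i) (piece j)
  iUnion_piece : ⋃ n, piece n = Set.univ

/-- The set `⋃_{N ≥ n} Ω_N ∪ {ω ∈ supp f : |f ω| > n}`. -/
def tailSet (D : FiniteDecomposition μ) (f : Ω →ₘ[μ] 𝕜) (n : ℕ) : Set Ω :=
  (⋃ N ≥ n, D.piece N) ∪ {ω | f ω ≠ 0 ∧ (n : ℝ) < ‖f ω‖}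

theorem measurableSet_tailSet (D : FiniteDecomposition μ) (f : Ω →ₘ[μ] 𝕜) (n : ℕ) :
    MeasurableSet (tailSet D f n) := by
  have hf : Measurable (f : Ω → 𝕜) := f.measurable
  refine MeasurableSet.union
    (MeasurableSet.iUnion fun N => MeasurableSet.iUnion fun _ => D.measurableSet_piece N) ?_
  exact (hf (measurableSet_singleton (0 : 𝕜)).compl).inter
    (measurableSet_lt measurable_const hf.norm)

end Koethe

end

/-! Write `U n` for the tail sets of the multiplier `lam`. The norms of `lam χ_{U n}` decrease, and
their limit turns out to be the distance from `mulOp X Y lam` to the weakly compact operators.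

Upper bound. Off `U n` the multiplier is at most `n χ_s`, where `s` is the support of `lam` minus `U
n`. This set has finite measure and `χ_s` has absolutely continuous norm. Such a multiplier acts
weakly compactly: the parts `|g| > r` of functions `g` in the unit ball contribute uniformly little
(`exists_uniform_truncation`), and the rest lands in an order interval of `Y`. That interval is
weakly compact, being the weakly continuous image of a bounded closed convex subset of `L²`
(`isCompact_orderInterval`). Grothendieck's criterion absorbs the small error. Removing this
operator from `mulOp X Y lam` leaves multiplication by `lam χ_{U n}`.

Lower bound. Suppose `mulOp X Y lam - W` has norm below some `r` that is smaller than all tail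
norms, with `W` weakly compact. The Fatou property yields disjoint differences `s k` of tail sets
and functions `v k` in the unit ball, supported on them, with `‖lam v k‖ > r`. The parts of `W (v
k)` on `s k` then stay away from zero. `exists_norm_cut_lt` forbids this: normalized, a subsequence
of these parts behaves like the `ℓ₁` basis, so some functional is uniformly positive on it;
Rosenthal's lemma makes the off-diagonal parts negligible; and at a weak cluster point the tails of
a convergent series would not tend to zero.

The equivalence follows: vanishing tails mean both norm approximation by weakly compact operators
and, by dominated convergence, order continuity. -/

noncomputable section

namespace Koethe

open scoped ENNReal

/-! ### Weak compactness in Banach spaces -/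

section AbstractWeak

open scoped Pointwise

variable {𝕜 E : Type*} [RCLike 𝕜] [NormedAddCommGroup E] [NormedSpace 𝕜 E]

/-- **Grothendieck's criterion**: a bounded set that is approximated arbitrarily well by weakly
compact sets is relatively weakly compact. -/
theorem isCompact_closure_of_approx [CompleteSpace E] {S : Set E} (hb : Bornology.IsBounded S)
    (h : ∀ ε > 0, ∃ K : Set (WeakSpace 𝕜 E), IsCompact K ∧
      ∀ y ∈ S, ∃ k : E, toWeakSpace 𝕜 E k ∈ K ∧ ‖y - k‖ ≤ ε) :
    IsCompact (closure (toWeakSpace 𝕜 E '' S)) := by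
  apply NormedSpace.isCompact_closure_of_isBounded
  · rwa [Set.preimage_image_eq _ (toWeakSpace 𝕜 E).injective]
  intro z hz
  set J := NormedSpace.inclusionInDoubleDualWeak 𝕜 E with hJ
  have key : ∀ ε > 0, ∃ k : E, ‖WeakDual.toStrongDual z
      - NormedSpace.inclusionInDoubleDual 𝕜 E k‖ ≤ ε := by
    intro ε hε
    obtain ⟨K, hK, hS⟩ := h ε hε
    -- A weak-star compact set plus a weak-star closed ball of the bidual is weak-star closed, so it
    -- contains `z` along with the image of `S`.
    have hcl : IsClosed (J '' K + WeakDual.toStrongDual ⁻¹' Metric.closedBall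
        (0 : StrongDual 𝕜 (StrongDual 𝕜 E)) ε) :=
      (WeakDual.isClosed_closedBall _ _).add_left_of_isCompact (hK.image J.continuous)
    have hsub : J '' (toWeakSpace 𝕜 E '' S) ⊆ J '' K + WeakDual.toStrongDual ⁻¹' Metric.closedBall
        (0 : StrongDual 𝕜 (StrongDual 𝕜 E)) ε := by
      rintro _ ⟨_, ⟨y, hy, rfl⟩, rfl⟩
      obtain ⟨k, hk, hyk⟩ := hS y hy
      refine Set.mem_add.2 ⟨J (toWeakSpace 𝕜 E k), ⟨_, hk, rfl⟩,
        J (toWeakSpace 𝕜 E (y - k)), ?_, ?_⟩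
      · exact (mem_closedBall_zero_iff (E := StrongDual 𝕜 (StrongDual 𝕜 E))).2
          (((NormedSpace.inclusionInDoubleDualLi (E := E) 𝕜).norm_map (y - k)).le.trans hyk)
      · rw [← map_add, ← map_add, add_sub_cancel]
    obtain ⟨_, ⟨w, hw, rfl⟩, b, hb, hab⟩ := Set.mem_add.1 (closure_minimal hsub hcl hz)
    refine ⟨(toWeakSpace 𝕜 E).symm w, ?_⟩
    have hb' : ‖WeakDual.toStrongDual b‖ ≤ ε :=
      (mem_closedBall_zero_iff (E := StrongDual 𝕜 (StrongDual 𝕜 E))).1 hb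
    have : WeakDual.toStrongDual z - NormedSpace.inclusionInDoubleDual 𝕜 E
        ((toWeakSpace 𝕜 E).symm w) = WeakDual.toStrongDual b := by
      ext f
      rw [← hab]
      exact add_sub_cancel_left (J w f) (b f)
    rw [this]
    exact hb'
  -- The canonical copy of a complete space is norm closed in the bidual, and `z` is at distance
  -- zero from it.
  have hrange :=
    (NormedSpace.inclusionInDoubleDualLi (E := E) 𝕜).isometry.isUniformInducing.isComplete_range.isClosed
  have hmem : WeakDual.toStrongDual z ∈
      Set.range (NormedSpace.inclusionInDoubleDualLi (E := E) 𝕜) := by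
    rw [← hrange.closure_eq, Metric.mem_closure_iff]
    intro ε hε
    obtain ⟨k, hk⟩ := key (ε / 2) (half_pos hε)
    refine ⟨_, ⟨k, rfl⟩, ?_⟩
    rw [dist_eq_norm]
    exact hk.trans_lt (half_lt_self hε)
  obtain ⟨k, hk⟩ := hmem
  exact ⟨toWeakSpace 𝕜 E k, hk⟩

/-- A free ultrafilter on the indices replaces the extraction of a weakly convergent subsequence;
eventual lower bounds for functionals survive in its limit. -/
theorem exists_weak_cluster {S : Set E} (hS : IsCompact (closure (toWeakSpace 𝕜 E '' S)))
    (x : ℕ → E) (hx : ∀ n, x n ∈ S) :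
    ∃ h : E, ∀ (φ : StrongDual 𝕜 E) (a : ℝ), (∀ᶠ n in atTop, a ≤ RCLike.re (φ (x n))) →
      a ≤ RCLike.re (φ h) := by
  let U : Ultrafilter (WeakSpace 𝕜 E) :=
    (Filter.hyperfilter ℕ).map (fun n => toWeakSpace 𝕜 E (x n))
  obtain ⟨h, -, hU⟩ := isCompact_iff_ultrafilter_le_nhds.1 hS U (by
    rw [Filter.le_principal_iff]
    exact Filter.mem_map.2
      (Filter.univ_mem' fun n => subset_closure (Set.mem_image_of_mem _ (hx n))))
  refine ⟨(toWeakSpace 𝕜 E).symm h, fun φ a hφ => ?_⟩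
  have ht : Tendsto (fun n => toWeakSpace 𝕜 E (x n)) (Filter.hyperfilter ℕ) (𝓝 h) := hU
  have h1 : Continuous fun w : WeakSpace 𝕜 E => RCLike.re (φ ((toWeakSpace 𝕜 E).symm w)) :=
    RCLike.continuous_re.comp (WeakBilin.eval_continuous (topDualPairing 𝕜 E).flip φ)
  refine ge_of_tendsto ((h1.tendsto h).comp ht) ?_
  have hle : ((Filter.hyperfilter ℕ : Ultrafilter ℕ) : Filter ℕ) ≤ atTop := by
    rw [← Nat.cofinite_eq_atTop]; exact Filter.hyperfilter_le_cofinite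
  exact hle hφ

/-- Bounded closed convex sets in a Hilbert space are weakly compact. -/
theorem isCompact_toWeakSpace_image {H : Type*} [NormedAddCommGroup H] [InnerProductSpace 𝕜 H]
    [CompleteSpace H] [NormedSpace ℝ H] [IsScalarTower ℝ 𝕜 H] {C : Set H}
    (hb : Bornology.IsBounded C) (hc : IsClosed C) (hconv : Convex ℝ C) :
    IsCompact (toWeakSpace 𝕜 H '' C) := by
  have h1 : IsCompact (closure (toWeakSpace 𝕜 H '' C)) := by
    apply NormedSpace.isCompact_closure_of_isBounded
    · rwa [Set.preimage_image_eq _ (toWeakSpace 𝕜 H).injective]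
    intro z _
    let ψ : StrongDual 𝕜 (StrongDual 𝕜 H) := WeakDual.toStrongDual z
    -- The Riesz map is conjugate-linear, so a conjugation is needed to make this functional linear;
    -- its own Riesz vector then represents `ψ`, which proves reflexivity.
    let l : H →ₗ[𝕜] 𝕜 :=
      { toFun := fun y => starRingEnd 𝕜 (ψ (InnerProductSpace.toDual 𝕜 H y))
        map_add' := fun a b => by simp
        map_smul' := fun c a => by
          rw [LinearIsometryEquiv.map_smulₛₗ, map_smul, smul_eq_mul, map_mul, RCLike.conj_conj]
          rfl }
    let L : StrongDual 𝕜 H := l.mkContinuous ‖ψ‖ fun y => by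
      change ‖starRingEnd 𝕜 (ψ (InnerProductSpace.toDual 𝕜 H y))‖ ≤ _
      rw [RCLike.norm_conj]
      refine (ψ.le_opNorm _).trans_eq ?_
      rw [LinearIsometryEquiv.norm_map]
    refine ⟨toWeakSpace 𝕜 H ((InnerProductSpace.toDual 𝕜 H).symm L), ?_⟩
    have : NormedSpace.inclusionInDoubleDual 𝕜 H ((InnerProductSpace.toDual 𝕜 H).symm L) = ψ := by
      ext f
      obtain ⟨y, rfl⟩ := (InnerProductSpace.toDual 𝕜 H).surjective f
      rw [NormedSpace.dual_def, InnerProductSpace.toDual_apply_apply, ← inner_conj_symm,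
        InnerProductSpace.toDual_symm_apply]
      exact RCLike.conj_conj _
    exact this
  rwa [← hconv.toWeakSpace_closure 𝕜, hc.closure_eq] at h1

/-- Mazur's theorem. -/
theorem isClosed_toWeakSpace_image [NormedSpace ℝ E] [IsScalarTower ℝ 𝕜 E] {C : Set E}
    (hc : IsClosed C) (hconv : Convex ℝ C) : IsClosed (toWeakSpace 𝕜 E '' C) := by
  have := hconv.toWeakSpace_closure 𝕜
  rw [hc.closure_eq] at this
  rw [this]
  exact isClosed_closure

/-- A sequence with a lower `ℓ₁`-estimate is uniformly positive for some bounded functional. -/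
theorem exists_functional_of_lower_estimate (x : ℕ → E) {c : ℝ} (hc : 0 < c)
    (hx : ∀ (F : Finset ℕ) (a : ℕ → 𝕜), c * ∑ k ∈ F, ‖a k‖ ≤ ‖∑ k ∈ F, a k • x k‖) :
    ∃ (φ : StrongDual 𝕜 E) (u : ℝ), 0 < u ∧ ∀ k, u ≤ RCLike.re (φ (x k)) := by
  let : NormedSpace ℝ E := NormedSpace.restrictScalars ℝ 𝕜 E
  have : IsScalarTower ℝ 𝕜 E := inferInstance
  let f : (ℕ →₀ ℝ) → E := fun w => ∑ k ∈ w.support, ((w k : ℝ) : 𝕜) • x k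
  have hf : ∀ (w : ℕ →₀ ℝ) (F : Finset ℕ), w.support ⊆ F → f w = ∑ k ∈ F, ((w k : ℝ) : 𝕜) • x k :=
    fun w F hF => Finset.sum_subset hF fun k _ hk => by
      rw [Finsupp.notMem_support_iff.1 hk]; simp
  -- The convex hull of the `x k`. The lower estimate keeps it at distance at least `c` from the
  -- origin, so Hahn–Banach separates its closure from 0.
  let C : Set E := f '' {w | (∀ k, 0 ≤ w k) ∧ ∑ k ∈ w.support, w k = 1}
  have hCconv : Convex ℝ C := by
    rintro _ ⟨w, ⟨hw0, hw1⟩, rfl⟩ _ ⟨v, ⟨hv0, hv1⟩, rfl⟩ a b ha hb hab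
    classical
    have hs : (a • w + b • v).support ⊆ w.support ∪ v.support :=
      Finsupp.support_add.trans (Finset.union_subset_union Finsupp.support_smul
        Finsupp.support_smul)
    refine ⟨a • w + b • v, ⟨fun k => ?_, ?_⟩, ?_⟩
    · have := hw0 k; have := hv0 k
      simp only [Finsupp.add_apply, Finsupp.smul_apply, smul_eq_mul]
      positivity
    · rw [Finset.sum_subset hs fun k _ hk => Finsupp.notMem_support_iff.1 hk]
      rw [Finset.sum_subset (Finset.subset_union_left (s₂ := v.support))
        fun k _ hk => Finsupp.notMem_support_iff.1 hk] at hw1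
      rw [Finset.sum_subset (Finset.subset_union_right (s₁ := w.support))
        fun k _ hk => Finsupp.notMem_support_iff.1 hk] at hv1
      simp only [Finsupp.add_apply, Finsupp.smul_apply, smul_eq_mul, Finset.sum_add_distrib,
        ← Finset.mul_sum, hw1, hv1, mul_one, hab]
    · rw [hf _ _ hs, hf w _ (Finset.subset_union_left (s₂ := v.support)),
        hf v _ (Finset.subset_union_right (s₁ := w.support)), Finset.smul_sum, Finset.smul_sum,
        ← Finset.sum_add_distrib]
      refine Finset.sum_congr rfl fun k _ => ?_
      rw [RCLike.real_smul_eq_coe_smul (K := 𝕜) a (_ : E),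
        RCLike.real_smul_eq_coe_smul (K := 𝕜) b (_ : E), smul_smul, smul_smul, ← add_smul]
      simp
  have hC : ∀ y ∈ C, c ≤ ‖y‖ := by
    rintro _ ⟨w, ⟨hw0, hw1⟩, rfl⟩
    refine le_trans (le_of_eq ?_) (hx w.support fun k => ((w k : ℝ) : 𝕜))
    simp only [RCLike.norm_ofReal, abs_of_nonneg (hw0 _), hw1, mul_one]
  have h0 : (0 : E) ∉ closure C := by
    intro h
    have : closure C ⊆ {y | c ≤ ‖y‖} :=
      closure_minimal hC (isClosed_le continuous_const continuous_norm)
    have h2 := this h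
    simp only [Set.mem_ofPred_eq, norm_zero] at h2
    linarith
  obtain ⟨φ, u, hu, hφ⟩ := RCLike.geometric_hahn_banach_point_closed (𝕜 := 𝕜) hCconv.closure
    isClosed_closure h0
  refine ⟨φ, u, by simpa using hu, fun k => (hφ _ (subset_closure ⟨Finsupp.single k 1, ?_, ?_⟩)).le⟩
  · refine ⟨fun j => ?_, ?_⟩
    · rw [Finsupp.single_apply]; split_ifs <;> norm_num
    · simp [Finsupp.support_single]
  · change ∑ j ∈ _, _ = _
    simp [Finsupp.support_single]

end AbstractWeak

/-- **Rosenthal's lemma**: a matrix with uniformly bounded row sums has an infinite submatrix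
whose off-diagonal row sums are small. -/
theorem exists_offDiag_tsum_le {ε : ℝ≥0∞} (hε : ε ≠ ⊤) (n : ℕ) (a : ℕ → ℕ → ℝ≥0∞)
    (ha : ∀ k, ∑' j, a k j ≤ n * ε) :
    ∃ ψ : ℕ → ℕ, Function.Injective ψ ∧
      ∀ k, ∑' j, (if j = k then 0 else a (ψ k) (ψ j)) ≤ ε := by
  induction n generalizing a with
  | zero =>
    refine ⟨id, Function.injective_id, fun k => le_trans ?_ ((ha k).trans (by simp))⟩
    refine ENNReal.tsum_le_tsum fun j => ?_
    split_ifs <;> simp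
  | succ n ih =>
    -- The sets of values of `Nat.pair p` split ℕ into infinitely many infinite classes. Either one
    -- class already works, or every class `p` has a row `i p` with off-diagonal sum above `ε`
    -- inside the class.
    by_cases hgood : ∃ p, ∀ k, ∑' j, (if j = k then 0 else a (Nat.pair p k) (Nat.pair p j)) ≤ ε
    · obtain ⟨p, hp⟩ := hgood
      exact ⟨Nat.pair p, fun i j h => (Nat.pair_eq_pair.1 h).2, hp⟩
    push Not at hgood
    choose i hi using hgood
    -- One bad index per class. The range of `κ` meets class `p` only there, so restricting the
    -- columns to this range costs the row more than `ε`: the bound `(n + 1) ε` drops to `n ε`.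
    let κ : ℕ → ℕ := fun p => Nat.pair p (i p)
    have hκ : Function.Injective κ := fun p q h => (Nat.pair_eq_pair.1 h).1
    obtain ⟨ψ, hψ, hψ'⟩ := ih (fun p q => a (κ p) (κ q)) (by
      intro p
      have hsplit : ∑' q, a (κ p) (κ q)
          + ∑' j, (if j = i p then 0 else a (κ p) (Nat.pair p j)) ≤ (n * ε) + ε := by
        have h1 : ∑' q, a (κ p) (κ q) = ∑' m : Set.range κ, a (κ p) m :=
          (Equiv.tsum_eq (Equiv.ofInjective κ hκ) (fun m : Set.range κ => a (κ p) m)).symm ▸ rfl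
        have h2 : ∑' j, (if j = i p then 0 else a (κ p) (Nat.pair p j))
            ≤ ∑' m : ((Set.range κ)ᶜ : Set ℕ), a (κ p) m := by
          rw [tsum_subtype]
          have hinj : Function.Injective (Nat.pair p) := fun i j h => (Nat.pair_eq_pair.1 h).2
          refine le_trans (ENNReal.tsum_le_tsum fun j => ?_)
            (ENNReal.tsum_comp_le_tsum_of_injective hinj _)
          split_ifs with hj
          · exact zero_le
          · rw [Set.indicator_of_mem]
            rintro ⟨q, hq⟩
            obtain ⟨rfl, h⟩ := Nat.pair_eq_pair.1 hq
            exact hj h.symm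
        calc _ ≤ ∑' m : Set.range κ, a (κ p) m + ∑' m : ((Set.range κ)ᶜ : Set ℕ), a (κ p) m := by
              rw [h1]; gcongr
          _ = ∑' m, a (κ p) m := ENNReal.summable.tsum_add_tsum_compl ENNReal.summable
          _ ≤ _ := (ha _).trans_eq (by push_cast; ring)
      exact (ENNReal.add_le_add_iff_right hε).1
        ((add_le_add le_rfl (hi p).le).trans hsplit))
    exact ⟨κ ∘ ψ, hκ.comp hψ, hψ'⟩

/-! ### Normed ideals of measurable functions: cuts and domination -/

variable {𝕜 Ω : Type*} [RCLike 𝕜] [MeasurableSpace Ω] {μ : Measure Ω}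

namespace NormedIdeal

variable (Z : NormedIdeal 𝕜 μ)

theorem coeFn_add (f g : Z.carrier) : ((f + g : Z.carrier) : Ω →ₘ[μ] 𝕜) =ᵐ[μ]
    fun ω => (f : Ω →ₘ[μ] 𝕜) ω + (g : Ω →ₘ[μ] 𝕜) ω :=
  AEEqFun.coeFn_add (f : Ω →ₘ[μ] 𝕜) g

theorem coeFn_sub (f g : Z.carrier) : ((f - g : Z.carrier) : Ω →ₘ[μ] 𝕜) =ᵐ[μ]
    fun ω => (f : Ω →ₘ[μ] 𝕜) ω - (g : Ω →ₘ[μ] 𝕜) ω :=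
  AEEqFun.coeFn_sub (f : Ω →ₘ[μ] 𝕜) g

theorem coeFn_smul (c : 𝕜) (f : Z.carrier) : ((c • f : Z.carrier) : Ω →ₘ[μ] 𝕜) =ᵐ[μ]
    fun ω => c * (f : Ω →ₘ[μ] 𝕜) ω :=
  AEEqFun.coeFn_smul c (f : Ω →ₘ[μ] 𝕜)

theorem coeFn_zero : ((0 : Z.carrier) : Ω →ₘ[μ] 𝕜) =ᵐ[μ] fun _ => (0 : 𝕜) :=
  AEEqFun.coeFn_zero

theorem coeFn_sum (F : Finset ℕ) (h : ℕ → Z.carrier) :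
    ((∑ i ∈ F, h i : Z.carrier) : Ω →ₘ[μ] 𝕜) =ᵐ[μ] fun ω => ∑ i ∈ F, (h i : Ω →ₘ[μ] 𝕜) ω := by
  induction F using Finset.induction_on with
  | empty => simpa using Z.coeFn_zero
  | insert i F hi ih =>
    filter_upwards [ih, Z.coeFn_add (h i) (∑ i ∈ F, h i)] with ω h1 h2
    rw [Finset.sum_insert hi, Finset.sum_insert hi, ← h1]
    exact h2

variable {Z} in
theorem ext_ae {f g : Z.carrier} (h : ∀ᵐ ω ∂μ, (f : Ω →ₘ[μ] 𝕜) ω = (g : Ω →ₘ[μ] 𝕜) ω) : f = g :=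
  Subtype.ext (AEEqFun.ext h)

theorem coeFn_cut (f : Z.carrier) (s : Set Ω) (hs : MeasurableSet s) :
    (Z.cut f s hs : Ω →ₘ[μ] 𝕜) =ᵐ[μ] s.indicator (f : Ω →ₘ[μ] 𝕜) := by
  filter_upwards [AEEqFun.coeFn_mul (f : Ω →ₘ[μ] 𝕜) (charFn 𝕜 μ s hs),
    coeFn_charFn (𝕜 := 𝕜) (μ := μ) s hs] with ω h₁ h₂
  change ((f : Ω →ₘ[μ] 𝕜) * charFn 𝕜 μ s hs) ω = _
  rw [h₁, Pi.mul_apply, h₂]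
  by_cases hω : ω ∈ s <;> simp [hω]

theorem norm_cut_le (f : Z.carrier) (s : Set Ω) (hs : MeasurableSet s) : ‖Z.cut f s hs‖ ≤ ‖f‖ := by
  apply Z.norm_le_of_le
  filter_upwards [Z.coeFn_cut f s hs] with ω h
  rw [h]
  exact norm_indicator_le_norm_self _ _

theorem norm_le_mul_of_le {f g : Z.carrier} {c : ℝ} (hc : 0 ≤ c)
    (h : ∀ᵐ ω ∂μ, ‖(f : Ω →ₘ[μ] 𝕜) ω‖ ≤ c * ‖(g : Ω →ₘ[μ] 𝕜) ω‖) : ‖f‖ ≤ c * ‖g‖ := by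
  have h1 : ‖f‖ ≤ ‖(c : 𝕜) • g‖ := by
    apply Z.norm_le_of_le
    filter_upwards [h, Z.coeFn_smul (c : 𝕜) g] with ω h1 h2
    rw [h2, norm_mul, RCLike.norm_ofReal, abs_of_nonneg hc]
    exact h1
  rwa [norm_smul, RCLike.norm_ofReal, abs_of_nonneg hc] at h1

theorem mem_of_le_mul {f : Ω →ₘ[μ] 𝕜} (g : Z.carrier) {c : ℝ}
    (h : ∀ᵐ ω ∂μ, ‖f ω‖ ≤ c * ‖(g : Ω →ₘ[μ] 𝕜) ω‖) : f ∈ Z.carrier := by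
  apply Z.mem_of_le ((c : 𝕜) • g)
  filter_upwards [h, Z.coeFn_smul (c : 𝕜) g] with ω h1 h2
  rw [h2, norm_mul, RCLike.norm_ofReal]
  exact h1.trans (mul_le_mul_of_nonneg_right (le_abs_self c) (norm_nonneg _))

theorem cut_add_cut_compl (f : Z.carrier) (s : Set Ω) (hs : MeasurableSet s) :
    Z.cut f s hs + Z.cut f sᶜ hs.compl = f := by
  apply ext_ae
  filter_upwards [Z.coeFn_add (Z.cut f s hs) (Z.cut f sᶜ hs.compl), Z.coeFn_cut f s hs,
    Z.coeFn_cut f sᶜ hs.compl] with ω h1 h2 h3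
  rw [h1, h2, h3]
  by_cases hω : ω ∈ s <;> simp [hω]

/-- Multiplication by the characteristic function of `s`, as a bounded operator. -/
def cutCLM (s : Set Ω) (hs : MeasurableSet s) : Z.carrier →L[𝕜] Z.carrier :=
  LinearMap.mkContinuous
    { toFun := fun f => Z.cut f s hs
      map_add' := fun f g => by
        apply ext_ae
        filter_upwards [Z.coeFn_add (Z.cut f s hs) (Z.cut g s hs), Z.coeFn_cut f s hs,
          Z.coeFn_cut g s hs, Z.coeFn_cut (f + g) s hs, Z.coeFn_add f g] with ω h1 h2 h3 h4 h5
        rw [h1, h2, h3, h4]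
        by_cases hω : ω ∈ s <;> simp only [hω, Set.indicator_of_mem, Set.indicator_of_notMem,
          not_false_eq_true, h5, add_zero]
      map_smul' := fun c f => by
        apply ext_ae
        filter_upwards [Z.coeFn_smul c (Z.cut f s hs), Z.coeFn_cut f s hs,
          Z.coeFn_cut (c • f) s hs, Z.coeFn_smul c f] with ω h1 h2 h3 h4
        rw [RingHom.id_apply, h1, h2, h3]
        by_cases hω : ω ∈ s <;> simp only [hω, Set.indicator_of_mem, Set.indicator_of_notMem,
          not_false_eq_true, h4, mul_zero] }
    1 fun f => by rw [one_mul]; exact Z.norm_cut_le f s hs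

theorem cutCLM_apply (s : Set Ω) (hs : MeasurableSet s) (f : Z.carrier) :
    Z.cutCLM s hs f = Z.cut f s hs := rfl

/-- Dominated convergence for a dominating element with absolutely continuous norm. -/
theorem HasAbsolutelyContinuousNorm.tendsto_norm_zero {Z : NormedIdeal 𝕜 μ} {e : Z.carrier}
    (he : Z.HasAbsolutelyContinuousNorm e) {h : ℕ → Z.carrier} {r : ℝ}
    (hr : ∀ n, ∀ᵐ ω ∂μ, ‖(h n : Ω →ₘ[μ] 𝕜) ω‖ ≤ r * ‖(e : Ω →ₘ[μ] 𝕜) ω‖)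
    (h0 : ∀ᵐ ω ∂μ, Tendsto (fun n => (h n : Ω →ₘ[μ] 𝕜) ω) atTop (𝓝 0)) :
    Tendsto (fun n => ‖h n‖) atTop (𝓝 0) := by
  rw [Metric.tendsto_atTop]
  intro δ hδ
  have hden : 0 < ‖e‖ + 1 := by positivity
  -- Chosen so that `ε ‖e‖ < δ / 2`; the summand 1 covers `e = 0`. On `t n` the bound `r |e|` and
  -- absolute continuity apply, off `t n` one has `|h n| ≤ ε |e|`.
  set ε : ℝ := δ / 2 / (‖e‖ + 1) with hεdef
  have hε : 0 < ε := by positivity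
  let t : ℕ → Set Ω := fun n =>
    ⋃ m ≥ n, {ω | ε * ‖(e : Ω →ₘ[μ] 𝕜) ω‖ < ‖(h m : Ω →ₘ[μ] 𝕜) ω‖}
  have htm : ∀ n, MeasurableSet (t n) := fun n =>
    MeasurableSet.iUnion fun m => MeasurableSet.iUnion fun _ =>
      measurableSet_lt ((e : Ω →ₘ[μ] 𝕜).measurable.norm.const_mul ε)
        (h m : Ω →ₘ[μ] 𝕜).measurable.norm
  have hta : Antitone t := fun a b hab => by
    intro ω hω
    simp only [t, Set.mem_iUnion] at hω ⊢
    obtain ⟨m, hm, h⟩ := hω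
    exact ⟨m, hab.trans hm, h⟩
  have htn : μ (⋂ n, t n) = 0 := by
    refine measure_mono_null (t := {ω | ¬ ((∀ n, ‖(h n : Ω →ₘ[μ] 𝕜) ω‖ ≤ r *
      ‖(e : Ω →ₘ[μ] 𝕜) ω‖) ∧ Tendsto (fun n => (h n : Ω →ₘ[μ] 𝕜) ω) atTop (𝓝 0))}) ?_
      ((ae_all_iff.2 hr).and h0)
    -- Where `e` vanishes so does every `h m`, and the strict inequality defining `t` fails;
    -- elsewhere `ε |e|` is positive and pointwise convergence expels the point from some `t N`.
    rintro ω hω ⟨h1, h2⟩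
    have hpos : 0 < ‖(e : Ω →ₘ[μ] 𝕜) ω‖ := by
      rw [norm_pos_iff]
      intro hz
      have := Set.mem_iInter.1 hω 0
      simp only [t, Set.mem_iUnion] at this
      obtain ⟨m, _, hm⟩ := this
      have h3 := h1 m
      simp only [Set.mem_ofPred_eq, hz, norm_zero, mul_zero] at hm h3
      exact absurd hm (not_lt.2 h3)
    obtain ⟨N, hN⟩ := Metric.tendsto_atTop.1 h2 _ (mul_pos hε hpos)
    have := Set.mem_iInter.1 hω N
    simp only [t, Set.mem_iUnion] at this
    obtain ⟨m, hm, hlt⟩ := this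
    have h3 := hN m hm
    rw [dist_zero_right] at h3
    exact absurd hlt (not_lt.2 h3.le)
  have hlim := (he t htm hta htn).const_mul |r|
  rw [mul_zero] at hlim
  obtain ⟨N, hN⟩ := Metric.tendsto_atTop.1 hlim (δ / 2) (half_pos hδ)
  refine ⟨N, fun n hn => ?_⟩
  rw [dist_zero_right, norm_norm]
  have h1 : ‖Z.cut (h n) (t n) (htm n)‖ ≤ |r| * ‖Z.cut e (t n) (htm n)‖ := by
    apply Z.norm_le_mul_of_le (abs_nonneg r)
    filter_upwards [hr n, Z.coeFn_cut (h n) (t n) (htm n), Z.coeFn_cut e (t n) (htm n)]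
      with ω a b c
    rw [b, c]
    by_cases hω : ω ∈ t n
    · simp only [hω, Set.indicator_of_mem]
      exact a.trans (mul_le_mul_of_nonneg_right (le_abs_self r) (norm_nonneg _))
    · simp [hω]
  have h2 : ‖Z.cut (h n) (t n)ᶜ (htm n).compl‖ ≤ ε * ‖e‖ := by
    apply Z.norm_le_mul_of_le hε.le
    filter_upwards [Z.coeFn_cut (h n) (t n)ᶜ (htm n).compl] with ω b
    rw [b]
    by_cases hω : ω ∈ t n
    · simp only [Set.mem_compl_iff, hω, not_true, not_false_eq_true, Set.indicator_of_notMem,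
        norm_zero]
      positivity
    · rw [Set.indicator_of_mem (by exact hω)]
      simp only [t, Set.mem_iUnion, not_exists] at hω
      exact not_lt.1 (hω n le_rfl)
  have h3 := hN n hn
  rw [dist_zero_right] at h3
  have h3 := (le_abs_self _).trans_lt h3
  have h4 : ε * ‖e‖ < δ / 2 := by
    rw [hεdef, div_mul_eq_mul_div, div_lt_iff₀ hden]
    have := half_pos hδ
    nlinarith [norm_nonneg e]
  calc ‖h n‖ = ‖Z.cut (h n) (t n) (htm n) + Z.cut (h n) (t n)ᶜ (htm n).compl‖ := by
        rw [Z.cut_add_cut_compl]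
    _ ≤ _ := norm_add_le _ _
    _ < δ := by linarith

end NormedIdeal

/-- A norm bounded sequence in a Köthe space is dominated, up to the weights `2 ^ n`, by a single
element. -/
theorem KoetheSpace.exists_dominating (X : KoetheSpace 𝕜 μ) (g : ℕ → X.carrier)
    (hg : ∀ n, ‖g n‖ ≤ 1) :
    ∃ h : X.carrier, ∀ n, ∀ᵐ ω ∂μ, ‖(g n : Ω →ₘ[μ] 𝕜) ω‖ ≤ 2 ^ n * ‖(h : Ω →ₘ[μ] 𝕜) ω‖ := by
  choose a ha ha' using fun n => exists_abs X.toNormedIdeal (g n)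
  -- The dominating element is the sum of the `2⁻ⁿ |g n|`; it converges by completeness and lies
  -- above each of its terms.
  let h : ℕ → X.carrier := fun n => (((1 / 2) ^ n : ℝ) : 𝕜) • a n
  have hh : ∀ n, ((h n : X.carrier) : Ω →ₘ[μ] 𝕜) =ᵐ[μ]
      fun ω => (((1 / 2) ^ n * ‖(g n : Ω →ₘ[μ] 𝕜) ω‖ : ℝ) : 𝕜) := by
    intro n
    filter_upwards [ha n, X.toNormedIdeal.coeFn_smul (((1 / 2) ^ n : ℝ) : 𝕜) (a n)] with ω h1 h2
    rw [h2, h1, ← RCLike.ofReal_mul]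
  have : CompleteSpace X.carrier := X.complete
  have hsum : Summable h := by
    refine Summable.of_norm_bounded summable_geometric_two fun n => ?_
    rw [norm_smul, RCLike.norm_ofReal, abs_of_pos (by positivity), ha' n]
    exact mul_le_of_le_one_right (by positivity) (hg n)
  refine ⟨∑' n, h n, fun n => ?_⟩
  have hle : ∀ᵐ ω ∂μ, RCLike.re ((h n : Ω →ₘ[μ] 𝕜) ω) ≤
      RCLike.re (((∑' n, h n : X.carrier) : Ω →ₘ[μ] 𝕜) ω) := by
    refine re_le_of_tendsto X.toNormedIdeal _ _ _ hsum.hasSum.tendsto_sum_nat ?_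
    filter_upwards [eventually_gt_atTop n] with m hm
    filter_upwards [ae_all_iff.2 hh, X.toNormedIdeal.coeFn_sum (Finset.range m) h] with ω h1 h2
    rw [h2, map_sum]
    refine Finset.single_le_sum (f := fun i => RCLike.re ((h i : Ω →ₘ[μ] 𝕜) ω))
      (fun i _ => ?_) (Finset.mem_range.2 hm)
    rw [h1 i, RCLike.ofReal_re]
    positivity
  filter_upwards [hle, hh n] with ω h1 h2
  rw [h2, RCLike.ofReal_re] at h1
  have h3 := h1.trans (RCLike.re_le_norm _)
  calc ‖(g n : Ω →ₘ[μ] 𝕜) ω‖ = 2 ^ n * ((1 / 2) ^ n * ‖(g n : Ω →ₘ[μ] 𝕜) ω‖) := by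
        rw [← mul_assoc, ← mul_pow]; norm_num
    _ ≤ _ := by gcongr

/-! ### Weak compactness of order intervals -/

namespace NormedIdeal

variable {Z : NormedIdeal 𝕜 μ}

/-- The elements `y` of the order interval `|y| ≤ r |e|` with `a ≤ Re (φ y)`, seen in `L²`. -/
def intervalHalfSpace (Z : NormedIdeal 𝕜 μ) (e : Z.carrier) (r : ℝ) (φ : StrongDual 𝕜 Z.carrier)
    (a : ℝ) : Set (Lp 𝕜 2 μ) :=
  {h | ∃ y : Z.carrier, (y : Ω →ₘ[μ] 𝕜) = h ∧
    (∀ᵐ ω ∂μ, ‖(y : Ω →ₘ[μ] 𝕜) ω‖ ≤ r * ‖(e : Ω →ₘ[μ] 𝕜) ω‖) ∧ a ≤ RCLike.re (φ y)}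

theorem convex_intervalHalfSpace (e : Z.carrier) (r : ℝ) (φ : StrongDual 𝕜 Z.carrier) (a : ℝ) :
    Convex ℝ (Z.intervalHalfSpace e r φ a) := by
  rintro h₁ ⟨y₁, e₁, b₁, p₁⟩ h₂ ⟨y₂, e₂, b₂, p₂⟩ s t hs ht hst
  refine ⟨(s : 𝕜) • y₁ + (t : 𝕜) • y₂, ?_, ?_, ?_⟩
  · apply AEEqFun.ext
    filter_upwards [Z.coeFn_add ((s : 𝕜) • y₁) ((t : 𝕜) • y₂), Z.coeFn_smul (s : 𝕜) y₁,
      Z.coeFn_smul (t : 𝕜) y₂, Lp.coeFn_add (s • h₁) (t • h₂), Lp.coeFn_smul s h₁,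
      Lp.coeFn_smul t h₂] with ω c₁ c₂ c₃ c₄ c₅ c₆
    rw [c₁, c₂, c₃, c₄, Pi.add_apply, c₅, c₆, Pi.smul_apply, Pi.smul_apply, e₁, e₂,
      RCLike.real_smul_eq_coe_mul, RCLike.real_smul_eq_coe_mul]
  · filter_upwards [Z.coeFn_add ((s : 𝕜) • y₁) ((t : 𝕜) • y₂), Z.coeFn_smul (s : 𝕜) y₁,
      Z.coeFn_smul (t : 𝕜) y₂, b₁, b₂] with ω c₁ c₂ c₃ c₄ c₅
    rw [c₁, c₂, c₃]
    refine (norm_add_le _ _).trans ?_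
    rw [norm_mul, norm_mul, RCLike.norm_ofReal, RCLike.norm_ofReal, abs_of_nonneg hs,
      abs_of_nonneg ht]
    calc _ ≤ s * (r * ‖(e : Ω →ₘ[μ] 𝕜) ω‖) + t * (r * ‖(e : Ω →ₘ[μ] 𝕜) ω‖) := by gcongr
      _ = _ := by rw [← add_mul, hst, one_mul]
  · rw [map_add, map_smul, map_smul, map_add, smul_eq_mul, smul_eq_mul, RCLike.re_ofReal_mul,
      RCLike.re_ofReal_mul]
    calc a = s * a + t * a := by rw [← add_mul, hst, one_mul]
      _ ≤ _ := by gcongr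

theorem isClosed_intervalHalfSpace {e : Z.carrier} (he : Z.HasAbsolutelyContinuousNorm e) (r : ℝ)
    (φ : StrongDual 𝕜 Z.carrier) (a : ℝ) : IsClosed (Z.intervalHalfSpace e r φ a) := by
  apply IsSeqClosed.isClosed
  intro h h₀ hh hlim
  choose y e₁ b₁ p₁ using hh
  -- An `L²` limit is an a.e. limit along a subsequence, and absolute continuity of `e` upgrades
  -- this to norm convergence in `Z`, where `φ` is continuous.
  obtain ⟨ns, -, hns⟩ := (tendstoInMeasure_of_tendsto_Lp hlim).exists_seq_tendsto_ae
  have hns' : ∀ᵐ ω ∂μ, Tendsto (fun i => (y (ns i) : Ω →ₘ[μ] 𝕜) ω) atTop (𝓝 (h₀ ω)) := by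
    filter_upwards [hns] with ω hω
    simpa only [e₁] using hω
  have hb : ∀ᵐ ω ∂μ, ‖(h₀ : Ω →ₘ[μ] 𝕜) ω‖ ≤ r * ‖(e : Ω →ₘ[μ] 𝕜) ω‖ := by
    filter_upwards [hns', ae_all_iff.2 b₁] with ω h1 h2
    exact le_of_tendsto h1.norm (Eventually.of_forall fun i => h2 (ns i))
  let y₀ : Z.carrier := ⟨h₀, Z.mem_of_le_mul e hb⟩
  refine ⟨y₀, rfl, hb, ?_⟩
  have hnorm : Tendsto (fun i => ‖y (ns i) - y₀‖) atTop (𝓝 0) := by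
    refine he.tendsto_norm_zero (r := r + r) (fun n => ?_) ?_
    · filter_upwards [b₁ (ns n), hb, Z.coeFn_sub (y (ns n)) y₀] with ω c₁ c₂ c₃
      rw [c₃, add_mul]
      exact (norm_sub_le _ _).trans (add_le_add c₁ c₂)
    · filter_upwards [hns', ae_all_iff.2 fun n => Z.coeFn_sub (y (ns n)) y₀] with ω c₁ c₂
      simp only [c₂]
      have := c₁.sub_const (h₀ ω)
      rwa [sub_self] at this
  have hy : Tendsto (fun i => y (ns i)) atTop (𝓝 y₀) := tendsto_iff_norm_sub_tendsto_zero.2 hnorm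
  exact ge_of_tendsto (((RCLike.continuous_re.comp φ.continuous).tendsto y₀).comp hy)
    (Eventually.of_forall fun i => p₁ (ns i))

/-- Order intervals generated by a characteristic function with absolutely continuous norm are
weakly compact. -/
theorem isCompact_orderInterval {s : Set Ω} {hs : MeasurableSet s} (hμs : μ s < ⊤)
    {e : Z.carrier} (hes : (e : Ω →ₘ[μ] 𝕜) = charFn 𝕜 μ s hs)
    (he : Z.HasAbsolutelyContinuousNorm e) (r : ℝ) :
    IsCompact (toWeakSpace 𝕜 Z.carrier ''
      {y | ∀ᵐ ω ∂μ, ‖(y : Ω →ₘ[μ] 𝕜) ω‖ ≤ r * ‖(e : Ω →ₘ[μ] 𝕜) ω‖}) := by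
  classical
  -- With `φ = 0` and `a = 0` the half-space condition is void, so `B` is the whole order interval.
  set B := Z.intervalHalfSpace e r 0 0 with hB
  let w : Lp 𝕜 2 μ := indicatorConstLp 2 hs hμs.ne (1 : 𝕜)
  have hw : ∀ᵐ ω ∂μ, (e : Ω →ₘ[μ] 𝕜) ω = w ω := by
    filter_upwards [coeFn_charFn (𝕜 := 𝕜) (μ := μ) s hs,
      indicatorConstLp_coeFn (p := 2) (hs := hs) (hμs := hμs.ne) (c := (1 : 𝕜))] with ω h1 h2
    rw [hes, h1]
    exact h2.symm
  have hBb : Bornology.IsBounded B := by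
    refine isBounded_iff_forall_norm_le.2 ⟨r * ‖w‖, ?_⟩
    rintro h ⟨y, e₁, b₁, -⟩
    apply Lp.norm_le_mul_norm_of_ae_le_mul
    filter_upwards [b₁, hw] with ω h1 h2
    rwa [← h2, ← e₁]
  have hBc : IsCompact (toWeakSpace 𝕜 (Lp 𝕜 2 μ) '' B) :=
    isCompact_toWeakSpace_image hBb (isClosed_intervalHalfSpace he r 0 0)
      (convex_intervalHalfSpace e r 0 0)
  let j : WeakSpace 𝕜 (Lp 𝕜 2 μ) → Z.carrier := fun h =>
    if hm : ((toWeakSpace 𝕜 (Lp 𝕜 2 μ)).symm h : Ω →ₘ[μ] 𝕜) ∈ Z.carrier then ⟨_, hm⟩ else 0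
  have hj : ∀ (h : Lp 𝕜 2 μ) (y : Z.carrier), (y : Ω →ₘ[μ] 𝕜) = h →
      j (toWeakSpace 𝕜 (Lp 𝕜 2 μ) h) = y := by
    intro h y hy
    have hm : ((toWeakSpace 𝕜 (Lp 𝕜 2 μ)).symm (toWeakSpace 𝕜 (Lp 𝕜 2 μ) h) : Ω →ₘ[μ] 𝕜)
        ∈ Z.carrier := by
      rw [LinearEquiv.symm_apply_apply, ← hy]
      exact y.2
    simp only [j, dif_pos hm]
    apply Subtype.ext
    simp only [LinearEquiv.symm_apply_apply, hy]
  have hcl : ∀ (φ : StrongDual 𝕜 Z.carrier) (a : ℝ),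
      IsClosed {h : (toWeakSpace 𝕜 (Lp 𝕜 2 μ) '' B : Set _) | a ≤ RCLike.re (φ (j h))} := by
    intro φ a
    -- The half-space sections of the interval are convex and norm closed in `L²`, hence weakly
    -- closed there; this is what makes `j` weakly continuous on `B`.
    have h1 := isClosed_toWeakSpace_image (𝕜 := 𝕜) (isClosed_intervalHalfSpace he r φ a)
      (convex_intervalHalfSpace e r φ a)
    convert h1.preimage continuous_subtype_val using 1
    ext ⟨_, h, ⟨y, e₁, b₁, p₁⟩, rfl⟩
    simp only [Set.mem_ofPred_eq, Set.mem_preimage]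
    rw [hj h y e₁, (toWeakSpace 𝕜 (Lp 𝕜 2 μ)).injective.mem_set_image]
    refine ⟨fun hp => ⟨y, e₁, b₁, hp⟩, ?_⟩
    rintro ⟨y', e₂, -, p₂⟩
    rwa [Subtype.ext (e₁.trans e₂.symm)]
  have hcont : ContinuousOn (fun h => toWeakSpace 𝕜 Z.carrier (j h))
      (toWeakSpace 𝕜 (Lp 𝕜 2 μ) '' B) := by
    rw [continuousOn_iff_continuous_domRestrict]
    refine WeakBilin.continuous_of_continuous_eval_re _ fun φ => ?_
    rw [continuous_iff_lower_upperSemicontinuous, lowerSemicontinuous_iff_isClosed_preimage,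
      upperSemicontinuous_iff_isClosed_preimage]
    refine ⟨fun a => ?_, fun a => hcl φ a⟩
    -- Upper half-spaces for `-φ` are lower half-spaces for `φ`.
    convert hcl (-φ) (-a) using 1
    ext h
    simp only [Set.mem_ofPred_eq, neg_apply, map_neg, neg_le_neg_iff]
    rfl
  convert hBc.image_of_continuousOn hcont using 1
  ext y
  constructor
  · rintro ⟨y, hy, rfl⟩
    have hm : (y : Ω →ₘ[μ] 𝕜) ∈ Lp 𝕜 2 μ := by
      apply Lp.mem_Lp_of_ae_le_mul (c := r) (g := w)
      filter_upwards [hy, hw] with ω h1 h2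
      rwa [← h2]
    exact ⟨_, ⟨⟨y, hm⟩, ⟨y, rfl, hy, by simp⟩, rfl⟩, congrArg _ (hj _ y rfl)⟩
  · rintro ⟨_, ⟨h, ⟨y, e₁, b₁, -⟩, rfl⟩, rfl⟩
    exact ⟨y, b₁, congrArg _ (hj h y e₁).symm⟩

end NormedIdeal

theorem mulOp_coeFn (X Y : KoetheSpace 𝕜 μ) (f : multipliers X Y) (g : X.carrier) :
    ((mulOp X Y f g : Ω →ₘ[μ] 𝕜) : Ω → 𝕜) =ᵐ[μ]
      fun ω => (f : Ω →ₘ[μ] 𝕜) ω * (g : Ω →ₘ[μ] 𝕜) ω :=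
  mulLin_coeFn X Y f g

theorem measurableSet_lt_norm (g : Ω →ₘ[μ] 𝕜) (r : ℝ) : MeasurableSet {ω | r < ‖g ω‖} :=
  measurableSet_lt measurable_const g.measurable.norm

/-! ### Weakly compact multiplication operators -/

section

variable [SigmaFinite μ] {X Y : KoetheSpace 𝕜 μ}

theorem norm_mulOp (f : (multiplierSpace X Y).carrier) : ‖mulOp X Y f‖ = ‖f‖ :=
  (multiplierNorm_eq_opNorm X Y f).symm

theorem norm_mulOp_apply_le (f : (multiplierSpace X Y).carrier) (g : X.carrier) :
    ‖mulOp X Y f g‖ ≤ ‖f‖ * ‖g‖ :=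
  le_multiplierNorm X Y f g

/-- A multiplier with absolutely continuous norm is uniformly small on the large parts of the
elements of the unit ball. -/
theorem exists_uniform_truncation {e : (multiplierSpace X Y).carrier}
    (he : (multiplierSpace X Y).HasAbsolutelyContinuousNorm e) {ε : ℝ} (hε : 0 < ε) :
    ∃ r : ℝ, 0 ≤ r ∧ ∀ g : X.carrier, ‖g‖ ≤ 1 →
      ‖mulOp X Y e (X.toNormedIdeal.cut g {ω | r < ‖(g : Ω →ₘ[μ] 𝕜) ω‖}
        (measurableSet_lt_norm _ r))‖ ≤ ε := by
  by_contra hcon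
  push Not at hcon
  -- The thresholds grow like `4 ^ n` because the domination by `h` costs a factor `2 ^ n`: where
  -- `|g n| > 4 ^ n`, still `|h| > 2 ^ n`, and these sets shrink to the empty set.
  choose g hg hg' using fun n : ℕ => hcon ((4 : ℝ) ^ n) (by positivity)
  obtain ⟨h, hh⟩ := X.exists_dominating g hg
  let t : ℕ → Set Ω := fun n => {ω | (2 : ℝ) ^ n < ‖(h : Ω →ₘ[μ] 𝕜) ω‖}
  have ht : ∀ n, MeasurableSet (t n) := fun n => measurableSet_lt_norm _ _
  have hta : Antitone t := fun a b hab ω hω =>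
    show (2 : ℝ) ^ a < ‖(h : Ω →ₘ[μ] 𝕜) ω‖ from lt_of_le_of_lt (pow_le_pow_right₀ one_le_two hab) hω
  have htn : μ (⋂ n, t n) = 0 := by
    convert measure_empty (μ := μ)
    rw [Set.eq_empty_iff_forall_notMem]
    intro ω hω
    obtain ⟨n, hn⟩ := pow_unbounded_of_one_lt ‖(h : Ω →ₘ[μ] 𝕜) ω‖ (one_lt_two (α := ℝ))
    exact lt_asymm hn (Set.mem_iInter.1 hω n)
  refine absurd (ge_of_tendsto (he t ht hta htn) (Eventually.of_forall fun n => ?_)) (not_le.2 hε)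
  refine (hg' n).le.trans ?_
  have h1 : ‖mulOp X Y e (X.toNormedIdeal.cut (g n) {ω | (4 : ℝ) ^ n < ‖(g n : Ω →ₘ[μ] 𝕜) ω‖}
      (measurableSet_lt_norm _ _))‖ ≤
      ‖mulOp X Y ((multiplierSpace X Y).cut e (t n) (ht n)) (g n)‖ := by
    apply Y.toNormedIdeal.norm_le_of_le
    filter_upwards [hh n, mulOp_coeFn X Y e (X.toNormedIdeal.cut (g n)
      {ω | (4 : ℝ) ^ n < ‖(g n : Ω →ₘ[μ] 𝕜) ω‖} (measurableSet_lt_norm _ _)),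
      mulOp_coeFn X Y ((multiplierSpace X Y).cut e (t n) (ht n)) (g n),
      X.toNormedIdeal.coeFn_cut (g n) {ω | (4 : ℝ) ^ n < ‖(g n : Ω →ₘ[μ] 𝕜) ω‖}
        (measurableSet_lt_norm _ _), (multiplierSpace X Y).coeFn_cut e (t n) (ht n)]
      with ω c₁ c₂ c₃ c₄ c₅
    rw [c₂, c₃, c₄, c₅]
    by_cases hω : (4 : ℝ) ^ n < ‖(g n : Ω →ₘ[μ] 𝕜) ω‖
    · have hω' : ω ∈ t n := by
        have h4 : (4 : ℝ) ^ n = 2 ^ n * 2 ^ n := by rw [← mul_pow]; norm_num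
        have := hω.trans_le c₁
        rw [h4] at this
        exact lt_of_mul_lt_mul_left this (by positivity)
      rw [Set.indicator_of_mem hω', Set.indicator_of_mem (by exact hω)]
    · rw [Set.indicator_of_notMem (by exact hω), mul_zero, norm_zero]
      exact norm_nonneg _
  refine h1.trans ((norm_mulOp_apply_le _ _).trans ?_)
  exact mul_le_of_le_one_right (norm_nonneg _) (hg n)

/-- An absolutely continuous characteristic function in `M(X, Y)` is absolutely continuous in
`Y`. -/
theorem hasAbsolutelyContinuousNorm_of_multiplier {s : Set Ω} {hs : MeasurableSet s}
    (hμs : μ s < ⊤) {e : (multiplierSpace X Y).carrier} (hes : (e : Ω →ₘ[μ] 𝕜) = charFn 𝕜 μ s hs)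
    (he : (multiplierSpace X Y).HasAbsolutelyContinuousNorm e) {y : Y.carrier}
    (hy : (y : Ω →ₘ[μ] 𝕜) = charFn 𝕜 μ s hs) :
    Y.toNormedIdeal.HasAbsolutelyContinuousNorm y := by
  intro t ht hta htn
  let x : X.carrier := ⟨charFn 𝕜 μ s hs, X.charFn_mem s hs hμs⟩
  have h := (he t ht hta htn).mul_const ‖x‖
  rw [zero_mul] at h
  refine squeeze_zero (fun n => norm_nonneg _) (fun n => ?_) h
  refine le_trans ?_ (norm_mulOp_apply_le _ x)
  apply Y.toNormedIdeal.norm_le_of_le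
  filter_upwards [Y.toNormedIdeal.coeFn_cut y (t n) (ht n),
    mulOp_coeFn X Y ((multiplierSpace X Y).cut e (t n) (ht n)) x,
    (multiplierSpace X Y).coeFn_cut e (t n) (ht n),
    coeFn_charFn (𝕜 := 𝕜) (μ := μ) s hs] with ω c₁ c₂ c₃ c₄
  rw [c₁, c₂, c₃, hes, hy]
  change _ ≤ ‖_ * charFn 𝕜 μ s hs ω‖
  by_cases h1 : ω ∈ t n <;> by_cases h2 : ω ∈ s <;> simp [h1, h2, c₄]

/-- A multiplier dominated by an absolutely continuous characteristic function acts as a weakly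
compact operator. -/
theorem isWeaklyCompactOperator_mulOp {s : Set Ω} {hs : MeasurableSet s} (hμs : μ s < ⊤)
    {e : (multiplierSpace X Y).carrier} (hes : (e : Ω →ₘ[μ] 𝕜) = charFn 𝕜 μ s hs)
    (he : (multiplierSpace X Y).HasAbsolutelyContinuousNorm e)
    (f : (multiplierSpace X Y).carrier) {c : ℝ} (hc : 0 ≤ c)
    (hf : ∀ᵐ ω ∂μ, ‖(f : Ω →ₘ[μ] 𝕜) ω‖ ≤ c * ‖(e : Ω →ₘ[μ] 𝕜) ω‖) :
    IsWeaklyCompactOperator (mulOp X Y f) := by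
  have : CompleteSpace Y.carrier := Y.complete
  intro B hB
  apply isCompact_closure_of_approx
  · exact (mulOp X Y f).lipschitz.isBounded_image hB
  intro ε hε
  obtain ⟨R, hR0, hR⟩ := hB.exists_pos_norm_le
  -- `R` undoes the scaling to the unit ball and `c` compares `f` with `e`; the summand 1 covers `c
  -- = 0`.
  obtain ⟨r, hr0, hr⟩ := exists_uniform_truncation he (ε := ε / (R * (c + 1))) (by positivity)
  let y : Y.carrier := ⟨charFn 𝕜 μ s hs, Y.charFn_mem s hs hμs⟩
  refine ⟨_, Y.toNormedIdeal.isCompact_orderInterval (hs := hs) hμs (e := y) rfl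
    (hasAbsolutelyContinuousNorm_of_multiplier hμs hes he rfl) (c * (R * r)), ?_⟩
  rintro _ ⟨g, hg, rfl⟩
  set g' : X.carrier := ((R⁻¹ : ℝ) : 𝕜) • g with hg'
  have hg'1 : ‖g'‖ ≤ 1 := by
    rw [hg', norm_smul, RCLike.norm_ofReal, abs_of_pos (by positivity), inv_mul_le_iff₀ hR0,
      mul_one]
    exact hR g hg
  have hgg' : g = (R : 𝕜) • g' := by
    rw [hg', smul_smul, ← RCLike.ofReal_mul, mul_inv_cancel₀ hR0.ne', RCLike.ofReal_one, one_smul]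
  have hm := measurableSet_lt_norm (g' : Ω →ₘ[μ] 𝕜) r
  -- The large part `a` gives the error; the part `b` is bounded by `r`, so `f` times `R b` lies in
  -- the order interval.
  set a := X.toNormedIdeal.cut g' {ω | r < ‖(g' : Ω →ₘ[μ] 𝕜) ω‖} hm with ha
  set b := X.toNormedIdeal.cut g' {ω | r < ‖(g' : Ω →ₘ[μ] 𝕜) ω‖}ᶜ hm.compl with hb
  have hab : a + b = g' := X.toNormedIdeal.cut_add_cut_compl g' _ hm
  refine ⟨mulOp X Y f ((R : 𝕜) • b), ⟨_, ?_, rfl⟩, ?_⟩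
  · filter_upwards [hf, mulOp_coeFn X Y f ((R : 𝕜) • b), X.toNormedIdeal.coeFn_smul (R : 𝕜) b,
      X.toNormedIdeal.coeFn_cut g' {ω | r < ‖(g' : Ω →ₘ[μ] 𝕜) ω‖}ᶜ hm.compl] with ω c₁ c₂ c₃ c₄
    rw [c₂, c₃, c₄, norm_mul, norm_mul, RCLike.norm_ofReal, abs_of_pos hR0]
    have h1 : ‖({ω | r < ‖(g' : Ω →ₘ[μ] 𝕜) ω‖}ᶜ).indicator (g' : Ω →ₘ[μ] 𝕜) ω‖ ≤ r := by
      by_cases hω : r < ‖(g' : Ω →ₘ[μ] 𝕜) ω‖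
      · simpa [hω] using hr0
      · rw [Set.indicator_of_mem (by exact hω)]
        exact not_lt.1 hω
    rw [hes] at c₁
    calc _ ≤ (c * ‖charFn 𝕜 μ s hs ω‖) * (R * r) := by gcongr
      _ = _ := by ring
  · rw [← map_sub, hgg', ← hab, smul_add, add_sub_cancel_right, map_smul, norm_smul,
      RCLike.norm_ofReal, abs_of_pos hR0]
    have h1 : ‖mulOp X Y f a‖ ≤ c * ‖mulOp X Y e a‖ := by
      apply Y.toNormedIdeal.norm_le_mul_of_le hc
      filter_upwards [hf, mulOp_coeFn X Y f a, mulOp_coeFn X Y e a] with ω c₁ c₂ c₃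
      rw [c₂, c₃, norm_mul, norm_mul, ← mul_assoc]
      gcongr
    have h2 := hr g' hg'1
    rw [← ha] at h2
    calc _ ≤ R * (c * (ε / (R * (c + 1)))) := by gcongr; exact h1.trans (by gcongr)
      _ = c / (c + 1) * ε := by field_simp
      _ ≤ 1 * ε := by gcongr; exact (div_le_one (by positivity)).2 (by linarith)
      _ = ε := one_mul ε

end

/-! ### Disjoint parts of weakly compact sequences -/

namespace NormedIdeal

variable (Z : NormedIdeal 𝕜 μ)

/-- Unimodular factors align the values of `φ`; since the sets are disjoint, the combination of cuts
is still dominated by `|y|`. -/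
theorem sum_norm_apply_cut_le (φ : StrongDual 𝕜 Z.carrier) {s : ℕ → Set Ω}
    (hs : ∀ n, MeasurableSet (s n)) (hd : Pairwise fun i j => Disjoint (s i) (s j))
    (y : Z.carrier) (F : Finset ℕ) :
    ∑ k ∈ F, ‖φ (Z.cut y (s k) (hs k))‖ ≤ ‖φ‖ * ‖y‖ := by
  choose a ha ha' using fun k => RCLike.exists_norm_eq_mul_self (φ (Z.cut y (s k) (hs k)))
  have h1 : ((∑ k ∈ F, ‖φ (Z.cut y (s k) (hs k))‖ : ℝ) : 𝕜)
      = φ (∑ k ∈ F, a k • Z.cut y (s k) (hs k)) := by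
    rw [map_sum, RCLike.ofReal_sum]
    refine Finset.sum_congr rfl fun k _ => ?_
    rw [map_smul, smul_eq_mul, ha' k]
  have h2 : ‖∑ k ∈ F, a k • Z.cut y (s k) (hs k)‖ ≤ ‖y‖ := by
    apply Z.norm_le_of_le
    filter_upwards [Z.coeFn_sum F fun k => a k • Z.cut y (s k) (hs k),
      ae_all_iff.2 fun k => Z.coeFn_smul (a k) (Z.cut y (s k) (hs k)),
      ae_all_iff.2 fun k => Z.coeFn_cut y (s k) (hs k)] with ω c₁ c₂ c₃
    rw [c₁]
    simp only [c₂, c₃]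
    by_cases hω : ∃ k ∈ F, ω ∈ s k
    · obtain ⟨k, hk, hωk⟩ := hω
      rw [Finset.sum_eq_single_of_mem k hk fun j _ hj => ?_]
      · rw [norm_mul, ha k, one_mul, Set.indicator_of_mem hωk]
      · rw [Set.indicator_of_notMem fun hωj => (Set.disjoint_left.1 (hd hj) hωj) hωk, mul_zero]
    · push Not at hω
      rw [Finset.sum_eq_zero fun j hj => by rw [Set.indicator_of_notMem (hω j hj), mul_zero],
        norm_zero]
      exact norm_nonneg _
  have h3 : 0 ≤ ∑ k ∈ F, ‖φ (Z.cut y (s k) (hs k))‖ := Finset.sum_nonneg fun _ _ => norm_nonneg _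
  rw [← abs_of_nonneg h3, ← RCLike.norm_ofReal (K := 𝕜), h1]
  exact (φ.le_opNorm _).trans (by gcongr)

/-- For a bounded functional `φ` and disjoint sets `s k`, the sum of the functionals
`y ↦ φ (y χ_{s k})` is a bounded functional. -/
theorem exists_hasSum_apply_cut (φ : StrongDual 𝕜 Z.carrier) {s : ℕ → Set Ω}
    (hs : ∀ n, MeasurableSet (s n)) (hd : Pairwise fun i j => Disjoint (s i) (s j)) :
    ∃ Φ : StrongDual 𝕜 Z.carrier, ∀ y, HasSum (fun k => φ (Z.cut y (s k) (hs k))) (Φ y) := by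
  have hsum : ∀ y, Summable fun k => φ (Z.cut y (s k) (hs k)) := fun y =>
    Summable.of_norm (summable_of_sum_le (fun _ => norm_nonneg _)
      (Z.sum_norm_apply_cut_le φ hs hd y))
  refine ⟨LinearMap.mkContinuous
    { toFun := fun y => ∑' k, φ (Z.cutCLM (s k) (hs k) y)
      map_add' := fun y z => by
        simp only [map_add]
        exact (hsum y).tsum_add (hsum z)
      map_smul' := fun c y => by
        simp only [map_smul, RingHom.id_apply, smul_eq_mul]
        exact tsum_mul_left } ‖φ‖ fun y => ?_, fun y => (hsum y).hasSum⟩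
  refine le_of_tendsto (hsum y).hasSum.norm (Eventually.of_forall fun F => ?_)
  exact (norm_sum_le _ _).trans (Z.sum_norm_apply_cut_le φ hs hd y F)

end NormedIdeal

/-- In a 1-disjointly homogeneous space, the disjoint parts of a relatively weakly compact
sequence are not bounded away from zero. -/
theorem KoetheSpace.IsOneDisjointlyHomogeneous.exists_norm_cut_lt {Y : KoetheSpace 𝕜 μ}
    (hDH : Y.IsOneDisjointlyHomogeneous) {S : Set Y.carrier}
    (hS : IsCompact (closure (toWeakSpace 𝕜 Y.carrier '' S))) {R : ℝ} (hSR : ∀ y ∈ S, ‖y‖ ≤ R)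
    (h : ℕ → Y.carrier) (hh : ∀ n, h n ∈ S) {s : ℕ → Set Ω} (hs : ∀ n, MeasurableSet (s n))
    (hd : Pairwise fun i j => Disjoint (s i) (s j)) {δ : ℝ} (hδ : 0 < δ) :
    ∃ k, ‖Y.toNormedIdeal.cut (h k) (s k) (hs k)‖ < δ := by
  by_contra hcon
  push Not at hcon
  set p : ℕ → ℕ → Y.carrier := fun i j => Y.toNormedIdeal.cut (h i) (s j) (hs j) with hp
  have hppos : ∀ k, 0 < ‖p k k‖ := fun k => hδ.trans_le (hcon k)
  obtain ⟨ϕ, hϕ, c, C, hc, -, hcC⟩ := hDH (fun k => ((‖p k k‖⁻¹ : ℝ) : 𝕜) • p k k)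
    (fun k => by
      rw [norm_smul, RCLike.norm_ofReal, abs_of_pos (inv_pos.2 (hppos k)),
        inv_mul_cancel₀ (hppos k).ne'])
    (fun i j hij => by
      filter_upwards [Y.toNormedIdeal.coeFn_smul ((‖p i i‖⁻¹ : ℝ) : 𝕜) (p i i),
        Y.toNormedIdeal.coeFn_smul ((‖p j j‖⁻¹ : ℝ) : 𝕜) (p j j),
        Y.toNormedIdeal.coeFn_cut (h i) (s i) (hs i),
        Y.toNormedIdeal.coeFn_cut (h j) (s j) (hs j)] with ω c₁ c₂ c₃ c₄
      rw [c₁, c₂, c₃, c₄]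
      by_cases hω : ω ∈ s i
      · right
        rw [Set.indicator_of_notMem (Set.disjoint_left.1 (hd hij) hω), mul_zero]
      · left
        rw [Set.indicator_of_notMem hω, mul_zero])
  obtain ⟨φ, v, hv, hφ⟩ := exists_functional_of_lower_estimate _ hc fun F a => (hcC F a).1
  set w : ℝ := δ * v with hw
  have hw0 : 0 < w := mul_pos hδ hv
  have hdiag : ∀ k, w ≤ RCLike.re (φ (p (ϕ k) (ϕ k))) := by
    intro k
    have h1 := hφ k
    rw [map_smul, smul_eq_mul, RCLike.re_ofReal_mul, ← div_eq_inv_mul, le_div_iff₀ (hppos _)] at h1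
    refine le_trans ?_ h1
    rw [hw, mul_comm]
    exact mul_le_mul_of_nonneg_left (hcon _) hv.le
  -- The row sums are at most `‖φ‖ R`, so `n` steps of size `w / 4` suffice in Rosenthal's lemma.
  obtain ⟨n, hn⟩ := exists_nat_gt (‖φ‖ * R / (w / 4))
  rw [div_lt_iff₀ (by positivity)] at hn
  have hdϕ : Pairwise fun i j => Disjoint (s (ϕ i)) (s (ϕ j)) :=
    fun i j hij => hd (hϕ.injective.ne hij)
  obtain ⟨ψ, hψ, hoff⟩ := exists_offDiag_tsum_le (ε := ENNReal.ofReal (w / 4))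
    ENNReal.ofReal_ne_top n (fun i j => ENNReal.ofReal ‖φ (p (ϕ i) (ϕ j))‖) (by
      intro k
      rw [ENNReal.tsum_eq_iSup_sum]
      refine iSup_le fun F => ?_
      rw [← ENNReal.ofReal_sum_of_nonneg fun _ _ => norm_nonneg _, ← ENNReal.ofReal_natCast,
        ← ENNReal.ofReal_mul (Nat.cast_nonneg n)]
      refine ENNReal.ofReal_le_ofReal (le_trans ?_ hn.le)
      refine (Y.toNormedIdeal.sum_norm_apply_cut_le φ (fun j => hs (ϕ j)) hdϕ _ F).trans ?_
      exact mul_le_mul_of_nonneg_left (hSR _ (hh _)) (norm_nonneg _))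
  set κ : ℕ → ℕ := ϕ ∘ ψ with hκ
  have hκi : Function.Injective κ := hϕ.injective.comp hψ
  have hoff' : ∀ i (F : Finset ℕ), i ∉ F → ∑ j ∈ F, ‖φ (p (κ i) (κ j))‖ ≤ w / 4 := by
    intro i F hi
    have h1 := (ENNReal.sum_le_tsum F).trans (hoff i)
    rw [Finset.sum_congr rfl fun j hj => if_neg fun hji : j = i => hi (hji ▸ hj),
      ← ENNReal.ofReal_sum_of_nonneg fun _ _ => norm_nonneg _] at h1
    exact (ENNReal.ofReal_le_ofReal_iff (by positivity)).1 h1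
  have hdκ : ∀ n : ℕ, Pairwise fun i j => Disjoint (s (κ (i + n))) (s (κ (j + n))) :=
    fun n i j hij => hd (hκi.ne (by simpa using hij))
  -- `Φ n` collects the columns from `n` on. At row `i ≥ n` it sees the diagonal term, at least `w`,
  -- and off-diagonal terms of total at most `w / 4`.
  choose Φ hΦ using fun n : ℕ =>
    Y.toNormedIdeal.exists_hasSum_apply_cut φ (fun j => hs (κ (j + n))) (hdκ n)
  obtain ⟨g, hg⟩ := exists_weak_cluster hS (fun i => h (κ i)) fun i => hh _
  have hlow : ∀ n, w / 2 ≤ RCLike.re (Φ n g) := by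
    intro n
    apply hg
    filter_upwards [eventually_ge_atTop n] with i hi
    obtain ⟨m, rfl⟩ := Nat.exists_eq_add_of_le' hi
    refine ge_of_tendsto ((RCLike.continuous_re.tendsto _).comp (hΦ n (h (κ (m + n))))) ?_
    filter_upwards [eventually_ge_atTop ({m} : Finset ℕ)] with F hF
    have hm : m ∈ F := hF (Finset.mem_singleton_self m)
    have h1 : ‖∑ j ∈ F.erase m, φ (p (κ (m + n)) (κ (j + n)))‖ ≤ w / 4 := by
      refine (norm_sum_le _ _).trans ?_
      have := hoff' (m + n) ((F.erase m).map (addRightEmbedding n)) (by simp)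
      rwa [Finset.sum_map] at this
    have h2 := (abs_le.1 ((RCLike.abs_re_le_norm _).trans h1)).1
    have h3 : w ≤ RCLike.re (φ (p (κ (m + n)) (κ (m + n)))) := hdiag _
    change w / 2 ≤ RCLike.re (∑ j ∈ F, φ (p (κ (m + n)) (κ (j + n))))
    rw [← Finset.add_sum_erase F _ hm, map_add]
    linarith
  -- At the fixed element `g`, the `Φ n` are the tails of one convergent series, against the lower
  -- bound `w / 2`.
  have hlim : Tendsto (fun n => Φ n g) atTop (𝓝 0) := by
    have h1 := tendsto_sum_nat_add fun j => φ (Y.toNormedIdeal.cut g (s (κ j)) (hs (κ j)))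
    refine h1.congr fun n => (hΦ n g).tsum_eq
  have := ge_of_tendsto ((RCLike.continuous_re.tendsto _).comp hlim) (Eventually.of_forall hlow)
  rw [map_zero] at this
  linarith

/-- The Fatou property for cuts along sets that exhaust the measure space. -/
theorem KoetheSpace.HasFatouProperty.norm_le_of_cut_compl {Y : KoetheSpace 𝕜 μ}
    (hY : Y.HasFatouProperty) {U : ℕ → Set Ω} (hU : ∀ n, MeasurableSet (U n))
    (hout : ∀ ω, ∀ᶠ n in atTop, ω ∉ U n) (y : Y.carrier) {r : ℝ} (hr : 0 < r)
    (hy : ∀ n, ‖Y.toNormedIdeal.cut y (U n)ᶜ (hU n).compl‖ ≤ r) : ‖y‖ ≤ r := by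
  have hn : ∀ z : Y.carrier, ‖((r⁻¹ : ℝ) : 𝕜) • z‖ = r⁻¹ * ‖z‖ := fun z => by
    rw [norm_smul, RCLike.norm_ofReal, abs_of_pos (inv_pos.2 hr)]
  set f : Y.carrier := ((r⁻¹ : ℝ) : 𝕜) • y with hf
  obtain ⟨_, h⟩ := hY (fun n => ((r⁻¹ : ℝ) : 𝕜) • Y.toNormedIdeal.cut y (U n)ᶜ (hU n).compl) f
    (fun n => by rw [hn, inv_mul_le_iff₀ hr, mul_one]; exact hy n)
    (Y.locallyIntegrable _ f.2) (fun s _ hμs => by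
      have : IsFiniteMeasure (μ.restrict s) := ⟨by simpa using hμs⟩
      refine tendstoInMeasure_of_tendsto_ae
        (fun n => (AEEqFun.aestronglyMeasurable _).restrict) (ae_restrict_of_ae ?_)
      filter_upwards [ae_all_iff.2 fun n => Y.toNormedIdeal.coeFn_smul ((r⁻¹ : ℝ) : 𝕜)
          (Y.toNormedIdeal.cut y (U n)ᶜ (hU n).compl),
        ae_all_iff.2 fun n => Y.toNormedIdeal.coeFn_cut y (U n)ᶜ (hU n).compl,
        Y.toNormedIdeal.coeFn_smul ((r⁻¹ : ℝ) : 𝕜) y] with ω c₁ c₂ c₃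
      refine tendsto_const_nhds.congr' ?_
      filter_upwards [hout ω] with n hω
      rw [c₁, c₂, c₃, Set.indicator_of_mem (by exact hω)])
  have h' : ‖f‖ ≤ 1 := h
  rwa [hf, hn, inv_mul_le_iff₀ hr, mul_one] at h'

/-! ### The lower bound for the weak essential norm -/

section

variable [SigmaFinite μ] {X Y : KoetheSpace 𝕜 μ}

/-- A test function nearly attains the norm on `U n`, and by the Fatou property its image already
exceeds `r` after a remote tail `U m` is removed. Iteration produces disjoint blocks. -/
theorem exists_disjoint_test_function (hY : Y.HasFatouProperty)
    (lam : (multiplierSpace X Y).carrier) {U : ℕ → Set Ω} (hU : ∀ n, MeasurableSet (U n))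
    (hout : ∀ ω, ∀ᶠ n in atTop, ω ∉ U n) {r : ℝ} (hr : 0 < r) (n : ℕ)
    (hn : r < ‖(multiplierSpace X Y).cut lam (U n) (hU n)‖) :
    ∃ m > n, ∃ g : X.carrier, ‖g‖ ≤ 1 ∧
      r < ‖Y.toNormedIdeal.cut (mulOp X Y lam g) (U n \ U m) ((hU n).diff (hU m))‖ := by
  obtain ⟨g, hg, hrg⟩ : ∃ g : X.carrier, ‖g‖ = 1 ∧
      r < ‖mulOp X Y ((multiplierSpace X Y).cut lam (U n) (hU n)) g‖ := by
    by_contra! hcon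
    refine absurd (Real.sSup_le ?_ hr.le) (not_le.2 hn)
    rintro _ ⟨g, hg, rfl⟩
    exact hcon g hg
  by_contra! hcon
  -- The shift by `n + 1` forces the removed index to exceed `n`.
  refine absurd (hY.norm_le_of_cut_compl (U := fun m => U (m + (n + 1))) (fun m => hU _)
    (fun ω => (tendsto_add_atTop_nat (n + 1)).eventually (hout ω)) _ hr fun m => ?_) (not_le.2 hrg)
  refine le_trans (le_of_eq ?_) (hcon (m + (n + 1)) (by omega) g hg.le)
  congr 1
  apply NormedIdeal.ext_ae
  filter_upwards [Y.toNormedIdeal.coeFn_cut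
      (mulOp X Y ((multiplierSpace X Y).cut lam (U n) (hU n)) g) (U (m + (n + 1)))ᶜ (hU _).compl,
    mulOp_coeFn X Y ((multiplierSpace X Y).cut lam (U n) (hU n)) g,
    (multiplierSpace X Y).coeFn_cut lam (U n) (hU n), mulOp_coeFn X Y lam g,
    Y.toNormedIdeal.coeFn_cut (mulOp X Y lam g) (U n \ U (m + (n + 1))) ((hU n).diff (hU _))]
    with ω c₁ c₂ c₃ c₄ c₅
  rw [c₁, c₅]
  by_cases h1 : ω ∈ U n <;> by_cases h2 : ω ∈ U (m + (n + 1)) <;> simp [h1, h2, c₂, c₃, c₄]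

/-- The distance of a multiplication operator to the weakly compact operators is bounded from
below by the norms of the tails of the multiplier. -/
theorem le_norm_mulOp_sub (hY : Y.HasFatouProperty) (hDH : Y.IsOneDisjointlyHomogeneous)
    (lam : (multiplierSpace X Y).carrier) {U : ℕ → Set Ω} (hU : ∀ n, MeasurableSet (U n))
    (hanti : Antitone U) (hout : ∀ ω, ∀ᶠ n in atTop, ω ∉ U n) {c : ℝ}
    (hc : ∀ n, c ≤ ‖(multiplierSpace X Y).cut lam (U n) (hU n)‖) {W : X.carrier →L[𝕜] Y.carrier}
    (hW : IsWeaklyCompactOperator W) : c ≤ ‖mulOp X Y lam - W‖ := by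
  by_contra! hlt
  obtain ⟨r, hr, hrc⟩ := exists_between hlt
  choose m hm g hg hrg using fun n => exists_disjoint_test_function hY lam hU hout
    ((norm_nonneg _).trans_lt hr) n (hrc.trans_le (hc n))
  -- Each block ends at the tail where the next one starts, so the sets `s k` are disjoint.
  let N : ℕ → ℕ := fun k => m^[k] 0
  have hN1 : ∀ k, N (k + 1) = m (N k) := fun k => Function.iterate_succ_apply' m k 0
  have hN : StrictMono N := strictMono_nat_of_lt_succ fun k => by rw [hN1]; exact hm _
  let s : ℕ → Set Ω := fun k => U (N k) \ U (m (N k))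
  have hs : ∀ k, MeasurableSet (s k) := fun k => (hU _).diff (hU _)
  have hd : Pairwise fun i j => Disjoint (s i) (s j) := by
    refine (pairwise_disjoint_on s).2 fun i j hij => ?_
    refine Set.disjoint_left.2 fun ω hi hj => hi.2 ?_
    rw [← hN1]
    exact hanti (hN.monotone hij) hj.1
  let v : ℕ → X.carrier := fun k => X.toNormedIdeal.cut (g (N k)) (s k) (hs k)
  have hv : ∀ k, ‖v k‖ ≤ 1 := fun k => (X.toNormedIdeal.norm_cut_le _ _ _).trans (hg _)
  obtain ⟨k, hk⟩ := hDH.exists_norm_cut_lt (S := W '' Metric.closedBall 0 1) (R := ‖W‖)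
    (hW _ Metric.isBounded_closedBall) (by
      rintro _ ⟨x, hx, rfl⟩
      exact (W.le_opNorm x).trans (mul_le_of_le_one_right (norm_nonneg _)
        (mem_closedBall_zero_iff.1 hx)))
    (fun k => W (v k)) (fun k => ⟨v k, mem_closedBall_zero_iff.2 (hv k), rfl⟩) hs hd
    (sub_pos.2 hr)
  have h1 : Y.toNormedIdeal.cut (mulOp X Y lam (g (N k))) (s k) (hs k)
      = Y.toNormedIdeal.cutCLM (s k) (hs k) (mulOp X Y lam (v k)) := by
    apply NormedIdeal.ext_ae
    rw [NormedIdeal.cutCLM_apply]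
    filter_upwards [Y.toNormedIdeal.coeFn_cut (mulOp X Y lam (g (N k))) (s k) (hs k),
      Y.toNormedIdeal.coeFn_cut (mulOp X Y lam (v k)) (s k) (hs k),
      mulOp_coeFn X Y lam (g (N k)), mulOp_coeFn X Y lam (v k),
      X.toNormedIdeal.coeFn_cut (g (N k)) (s k) (hs k)] with ω c₁ c₂ c₃ c₄ c₅
    rw [c₁, c₂]
    by_cases hω : ω ∈ s k
    · rw [Set.indicator_of_mem hω, Set.indicator_of_mem hω, c₃, c₄, c₅, Set.indicator_of_mem hω]
    · rw [Set.indicator_of_notMem hω, Set.indicator_of_notMem hω]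
  -- On `s k` the left side has norm above `r`, the first summand at most `‖mulOp X Y lam - W‖`, and
  -- the second less than the difference of the two.
  have h2 : mulOp X Y lam (v k) = (mulOp X Y lam - W) (v k) + W (v k) := by simp
  have h3 : r < ‖Y.toNormedIdeal.cut (mulOp X Y lam (g (N k))) (s k) (hs k)‖ := hrg (N k)
  rw [h1, h2, map_add] at h3
  have h4 : ‖Y.toNormedIdeal.cutCLM (s k) (hs k) ((mulOp X Y lam - W) (v k))‖
      ≤ ‖mulOp X Y lam - W‖ :=
    (Y.toNormedIdeal.norm_cut_le _ _ _).trans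
      (((mulOp X Y lam - W).le_opNorm _).trans (mul_le_of_le_one_right (norm_nonneg _) (hv k)))
  have h5 : ‖Y.toNormedIdeal.cutCLM (s k) (hs k) (W (v k))‖ < r - ‖mulOp X Y lam - W‖ := hk
  have h6 := norm_add_le (Y.toNormedIdeal.cutCLM (s k) (hs k) ((mulOp X Y lam - W) (v k)))
    (Y.toNormedIdeal.cutCLM (s k) (hs k) (W (v k)))
  linarith

end

/-! ### Tail sets, norm approximation and order continuity -/

theorem antitone_tailSet (D : FiniteDecomposition μ) (f : Ω →ₘ[μ] 𝕜) : Antitone (tailSet D f) := by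
  rintro a b hab ω (hω | ⟨h0, hω⟩)
  · left
    simp only [Set.mem_iUnion] at hω ⊢
    obtain ⟨N, hN, h⟩ := hω
    exact ⟨N, le_trans hab hN, h⟩
  · exact Or.inr ⟨h0, lt_of_le_of_lt (Nat.cast_le.2 hab) hω⟩

theorem eventually_notMem_tailSet (D : FiniteDecomposition μ) (f : Ω →ₘ[μ] 𝕜) (ω : Ω) :
    ∀ᶠ n in atTop, ω ∉ tailSet D f n := by
  obtain ⟨N, hN⟩ := Set.mem_iUnion.1 (D.iUnion_piece.symm ▸ Set.mem_univ ω)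
  obtain ⟨M, hM⟩ := exists_nat_ge ‖f ω‖
  filter_upwards [eventually_gt_atTop N, eventually_ge_atTop M] with n hn hn'
  rintro (hω | ⟨-, hω⟩)
  · simp only [Set.mem_iUnion] at hω
    obtain ⟨N', hN', h⟩ := hω
    exact Set.disjoint_left.1 (D.disjoint_piece (show N' ≠ N by omega)) h hN
  · have h1 : (M : ℝ) ≤ n := Nat.cast_le.2 hn'
    have h2 : (n : ℝ) < ‖f ω‖ := hω
    linarith

theorem measure_iInter_tailSet (D : FiniteDecomposition μ) (f : Ω →ₘ[μ] 𝕜) :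
    μ (⋂ n, tailSet D f n) = 0 := by
  convert measure_empty (μ := μ)
  rw [Set.eq_empty_iff_forall_notMem]
  intro ω hω
  obtain ⟨n, hn⟩ := (eventually_notMem_tailSet D f ω).exists
  exact hn (Set.mem_iInter.1 hω n)

theorem measure_compl_tailSet_lt_top (D : FiniteDecomposition μ) (f : Ω →ₘ[μ] 𝕜) (n : ℕ) :
    μ (tailSet D f n)ᶜ < ⊤ := by
  refine lt_of_le_of_lt (measure_mono (t := ⋃ N ∈ Finset.range n, D.piece N) fun ω hω => ?_)
    (measure_biUnion_lt_top (Finset.finite_toSet _) fun N _ => D.measure_piece_lt_top N)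
  obtain ⟨N, hN⟩ := Set.mem_iUnion.1 (D.iUnion_piece.symm ▸ Set.mem_univ ω)
  refine Set.mem_biUnion (Finset.mem_range.2 ?_) hN
  by_contra hn
  exact hω (Or.inl (Set.mem_biUnion (not_lt.1 hn) hN))

/-- Norm limits of weakly compact operators are weakly compact, by Grothendieck's criterion applied
to the images of a bounded set. -/
theorem isWeaklyCompactOperator_of_approx {E F : Type*} [NormedAddCommGroup E] [NormedSpace 𝕜 E]
    [NormedAddCommGroup F] [NormedSpace 𝕜 F] [CompleteSpace F] {T : E →L[𝕜] F}
    (h : ∀ ε > 0, ∃ W : E →L[𝕜] F, IsWeaklyCompactOperator W ∧ ‖T - W‖ ≤ ε) :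
    IsWeaklyCompactOperator T := by
  intro B hB
  apply isCompact_closure_of_approx (T.lipschitz.isBounded_image hB)
  intro ε hε
  obtain ⟨R, hR0, hR⟩ := hB.exists_pos_norm_le
  obtain ⟨W, hW, hTW⟩ := h (ε / R) (by positivity)
  refine ⟨_, hW B hB, ?_⟩
  rintro _ ⟨x, hx, rfl⟩
  refine ⟨W x, subset_closure ⟨_, ⟨x, hx, rfl⟩, rfl⟩, ?_⟩
  rw [← sub_apply]
  calc _ ≤ ‖T - W‖ * ‖x‖ := (T - W).le_opNorm x
    _ ≤ ε / R * R := mul_le_mul hTW (hR x hx) (norm_nonneg _) (by positivity)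
    _ = ε := div_mul_cancel₀ _ hR0.ne'

section

variable [SigmaFinite μ] {X Y : KoetheSpace 𝕜 μ}

/-- Off its tail sets, a multiplier is dominated by an absolutely continuous characteristic
function. -/
theorem exists_dominating_charFn
    (hchar : (multiplierSpace X Y).ContainsCharFnsInSupport)
    (hsimple : ∀ f : (multiplierSpace X Y).carrier, (f : Ω →ₘ[μ] 𝕜) ∈ simpleFunctions 𝕜 μ →
      (multiplierSpace X Y).HasAbsolutelyContinuousNorm f)
    (D : FiniteDecomposition μ) (lam : (multiplierSpace X Y).carrier) (n : ℕ) :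
    ∃ (s : Set Ω) (hs : MeasurableSet s) (e : (multiplierSpace X Y).carrier), μ s < ⊤ ∧
      (e : Ω →ₘ[μ] 𝕜) = charFn 𝕜 μ s hs ∧ (multiplierSpace X Y).HasAbsolutelyContinuousNorm e ∧
      ∀ᵐ ω ∂μ, ‖((multiplierSpace X Y).cut lam (tailSet D (lam : Ω →ₘ[μ] 𝕜) n)ᶜ
        (measurableSet_tailSet D (lam : Ω →ₘ[μ] 𝕜) n).compl : Ω →ₘ[μ] 𝕜) ω‖ ≤
        n * ‖(e : Ω →ₘ[μ] 𝕜) ω‖ := by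
  -- Intersecting with the support makes `hchar` applicable; leaving the tail set gives finite
  -- measure and `|lam| ≤ n`.
  let s : Set Ω := (lam : Ω →ₘ[μ] 𝕜) ⁻¹' {0}ᶜ ∩ (tailSet D (lam : Ω →ₘ[μ] 𝕜) n)ᶜ
  have hs : MeasurableSet s :=
    ((lam : Ω →ₘ[μ] 𝕜).measurable (measurableSet_singleton (0 : 𝕜)).compl).inter
      (measurableSet_tailSet D (lam : Ω →ₘ[μ] 𝕜) n).compl
  have hμs : μ s < ⊤ := (measure_mono Set.inter_subset_right).trans_lt
    (measure_compl_tailSet_lt_top D (lam : Ω →ₘ[μ] 𝕜) n)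
  have he := hchar lam s hs hμs (Eventually.of_forall fun ω hω => hω.1)
  refine ⟨s, hs, ⟨_, he⟩, hμs, rfl, hsimple _ (Submodule.subset_span ⟨s, hs, hμs, rfl⟩), ?_⟩
  filter_upwards [coeFn_charFn (𝕜 := 𝕜) (μ := μ) s hs, (multiplierSpace X Y).coeFn_cut lam
    (tailSet D (lam : Ω →ₘ[μ] 𝕜) n)ᶜ (measurableSet_tailSet D (lam : Ω →ₘ[μ] 𝕜) n).compl]
    with ω c₁ c₂
  rw [c₁, c₂]
  by_cases hω : ω ∈ s
  · rw [Set.indicator_of_mem hω, Set.indicator_of_mem hω.2, norm_one, mul_one]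
    by_contra! hlt
    exact hω.2 (Or.inr ⟨hω.1, hlt⟩)
  · rw [Set.indicator_of_notMem hω, norm_zero, mul_zero]
    refine (norm_eq_zero.2 ?_).le
    by_cases h0 : (lam : Ω →ₘ[μ] 𝕜) ω = 0
    · rw [Set.indicator_apply_eq_zero]
      exact fun _ => h0
    · exact Set.indicator_of_notMem (fun h => hω ⟨h0, h⟩) _

theorem mulOp_sub_mulOp_cut_compl (lam : (multiplierSpace X Y).carrier) (s : Set Ω)
    (hs : MeasurableSet s) :
    mulOp X Y lam - mulOp X Y ((multiplierSpace X Y).cut lam sᶜ hs.compl)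
      = mulOp X Y ((multiplierSpace X Y).cut lam s hs) := by
  rw [sub_eq_iff_eq_add]
  refine Eq.trans ?_ (mulOp_add X Y _ _)
  exact congrArg (mulOp X Y) ((multiplierSpace X Y).cut_add_cut_compl lam s hs).symm

end

/-- For an order continuous element, the norms of the cuts along decreasing sets with null
intersection tend to zero. -/
theorem NormedIdeal.IsOrderContinuous.hasAbsolutelyContinuousNorm {Z : NormedIdeal 𝕜 μ}
    {f : Z.carrier} (hf : Z.IsOrderContinuous f) : Z.HasAbsolutelyContinuousNorm f := by
  intro s hs hanti hnull
  choose u hu hu' using fun n => exists_abs Z (Z.cut f (s n) (hs n))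
  simp only [← hu']
  refine hf u (fun n => ?_) ?_
  · filter_upwards [hu n, hu (n + 1), Z.coeFn_cut f (s n) (hs n),
      Z.coeFn_cut f (s (n + 1)) (hs (n + 1))] with ω c₁ c₂ c₃ c₄
    rw [c₁, c₂, c₃, c₄]
    simp only [RCLike.norm_ofReal, abs_norm, true_and]
    exact ⟨norm_indicator_le_norm_self _ _,
      norm_indicator_le_of_subset (hanti (Nat.le_succ n)) _ _⟩
  · have hout : ∀ᵐ ω ∂μ, ω ∉ ⋂ n, s n := measure_eq_zero_iff_ae_notMem.1 hnull
    filter_upwards [ae_all_iff.2 hu, ae_all_iff.2 fun n => Z.coeFn_cut f (s n) (hs n), hout]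
      with ω c₁ c₂ hω
    obtain ⟨n, hn⟩ : ∃ n, ω ∉ s n := by simpa using hω
    refine tendsto_const_nhds.congr' ?_
    filter_upwards [eventually_ge_atTop n] with m hm
    rw [c₁, c₂, Set.indicator_of_notMem fun h => hn (hanti hm h)]
    simp

/-- An element is order continuous if, up to parts of small norm, it is dominated by elements
with absolutely continuous norm. -/
theorem NormedIdeal.isOrderContinuous_of_approx {Z : NormedIdeal 𝕜 μ} {f : Z.carrier}
    (h : ∀ ε > 0, ∃ (s : Set Ω) (hs : MeasurableSet s) (e : Z.carrier) (r : ℝ),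
      ‖Z.cut f s hs‖ < ε ∧ Z.HasAbsolutelyContinuousNorm e ∧
      ∀ᵐ ω ∂μ, ‖(Z.cut f sᶜ hs.compl : Ω →ₘ[μ] 𝕜) ω‖ ≤ r * ‖(e : Ω →ₘ[μ] 𝕜) ω‖) :
    Z.IsOrderContinuous f := by
  intro u hu hu0
  rw [Metric.tendsto_atTop]
  intro ε hε
  -- On `s` every `u n` is as small in norm as `f`; off `s` dominated convergence applies.
  obtain ⟨s, hs, e, r, hsε, he, hr⟩ := h (ε / 2) (half_pos hε)
  have h1 : ∀ n, ‖Z.cut (u n) s hs‖ ≤ ‖Z.cut f s hs‖ := by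
    intro n
    apply Z.norm_le_of_le
    filter_upwards [hu n, Z.coeFn_cut (u n) s hs, Z.coeFn_cut f s hs] with ω c₁ c₂ c₃
    rw [c₂, c₃]
    by_cases hω : ω ∈ s
    · simpa [hω] using c₁.2.1
    · simp [hω]
  have h2 : Tendsto (fun n => ‖Z.cut (u n) sᶜ hs.compl‖) atTop (𝓝 0) := by
    refine he.tendsto_norm_zero (r := r) (fun n => ?_) ?_
    · filter_upwards [hu n, Z.coeFn_cut (u n) sᶜ hs.compl, Z.coeFn_cut f sᶜ hs.compl, hr]
        with ω c₁ c₂ c₃ c₄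
      refine le_trans ?_ c₄
      rw [c₂, c₃]
      by_cases hω : ω ∈ s
      · simp [hω]
      · simpa [hω] using c₁.2.1
    · filter_upwards [hu0, ae_all_iff.2 fun n => Z.coeFn_cut (u n) sᶜ hs.compl] with ω c₁ c₂
      simp only [c₂]
      by_cases hω : ω ∈ s
      · simp [hω]
      · simpa [hω] using c₁
  obtain ⟨N, hN⟩ := Metric.tendsto_atTop.1 h2 (ε / 2) (half_pos hε)
  refine ⟨N, fun n hn => ?_⟩
  have h3 := hN n hn
  rw [dist_zero_right, norm_norm] at h3 ⊢
  have h4 := norm_add_le (Z.cut (u n) s hs) (Z.cut (u n) sᶜ hs.compl)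
  rw [Z.cut_add_cut_compl] at h4
  have := h1 n
  linarith

end Koethe

end

/-! ### The weak essential norm formula and the characterization -/

open Koethe in
theorem mainTheorem5 {𝕜 Ω : Type*} [RCLike 𝕜] [MeasurableSpace Ω] (μ : Measure Ω)
    [μ.IsComplete] [SigmaFinite μ] (hμ : IsNonatomic μ)
    (X Y : KoetheSpace 𝕜 μ) (hX : X.HasFatouProperty) (hY : Y.HasFatouProperty)
    (hDH : Y.IsOneDisjointlyHomogeneous)
    (hchar : (multiplierSpace X Y).ContainsCharFnsInSupport)
    (hsimple : ∀ f : (multiplierSpace X Y).carrier, (f : Ω →ₘ[μ] 𝕜) ∈ simpleFunctions 𝕜 μ →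
      (multiplierSpace X Y).HasAbsolutelyContinuousNorm f)
    (D : FiniteDecomposition μ) (lam : (multiplierSpace X Y).carrier) :
    Tendsto (fun n : ℕ => ‖(multiplierSpace X Y).cut lam (tailSet D (lam : Ω →ₘ[μ] 𝕜) n)
        (measurableSet_tailSet D (lam : Ω →ₘ[μ] 𝕜) n)‖)
      atTop (𝓝 (weakEssentialNorm (mulOp X Y lam))) ∧
    (IsWeaklyCompactOperator (mulOp X Y lam) ↔
      (multiplierSpace X Y).IsOrderContinuous lam) := by
  have : CompleteSpace Y.carrier := Y.complete
  set U : ℕ → Set Ω := tailSet D (lam : Ω →ₘ[μ] 𝕜)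
  have hU : ∀ n, MeasurableSet (U n) := measurableSet_tailSet D (lam : Ω →ₘ[μ] 𝕜)
  have hanti : Antitone U := antitone_tailSet D _
  set a : ℕ → ℝ := fun n => ‖(multiplierSpace X Y).cut lam (U n) (hU n)‖ with ha
  have haanti : Antitone a := by
    intro m n hmn
    apply (multiplierSpace X Y).norm_le_of_le
    filter_upwards [(multiplierSpace X Y).coeFn_cut lam (U m) (hU m),
      (multiplierSpace X Y).coeFn_cut lam (U n) (hU n)] with ω c₁ c₂
    rw [c₁, c₂]
    exact norm_indicator_le_of_subset (hanti hmn) _ _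
  have hbdd : BddBelow (Set.range a) := ⟨0, by rintro _ ⟨n, rfl⟩; exact norm_nonneg _⟩
  have hlim : Tendsto a atTop (𝓝 (⨅ n, a n)) := tendsto_atTop_ciInf haanti hbdd
  have hlow : ∀ W : X.carrier →L[𝕜] Y.carrier, IsWeaklyCompactOperator W →
      ⨅ n, a n ≤ ‖mulOp X Y lam - W‖ := fun W hW =>
    le_norm_mulOp_sub hY hDH lam hU hanti (eventually_notMem_tailSet D _)
      (fun n => ciInf_le hbdd n) hW
  have hdom := exists_dominating_charFn hchar hsimple D lam
  have hup : ∀ n, ∃ W : X.carrier →L[𝕜] Y.carrier, IsWeaklyCompactOperator W ∧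
      a n = ‖mulOp X Y lam - W‖ := by
    intro n
    obtain ⟨s, hs, e, hμs, hes, he, hle⟩ := hdom n
    -- `W` is multiplication by `lam` cut off outside `U n`; the remainder is multiplication by `lam
    -- χ_{U n}`, of norm `a n`.
    refine ⟨_, isWeaklyCompactOperator_mulOp hμs hes he _ (Nat.cast_nonneg n) hle, ?_⟩
    rw [mulOp_sub_mulOp_cut_compl lam (U n) (hU n), norm_mulOp]
  have hnorm : weakEssentialNorm (mulOp X Y lam) = ⨅ n, a n := by
    apply le_antisymm
    · refine le_ciInf fun n => csInf_le ⟨0, ?_⟩ (hup n)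
      rintro _ ⟨W, -, rfl⟩
      exact norm_nonneg _
    · refine le_csInf ⟨_, hup 0⟩ ?_
      rintro _ ⟨W, hW, rfl⟩
      exact hlow W hW
  refine ⟨hnorm ▸ hlim, fun hW => ?_, fun hoc => ?_⟩
  -- The lower bound is used with `W` equal to the operator itself.
  · have h0 : ⨅ n, a n ≤ 0 := by simpa using hlow _ hW
    refine NormedIdeal.isOrderContinuous_of_approx fun ε hε => ?_
    obtain ⟨n, hn⟩ := (hlim.eventually (gt_mem_nhds (h0.trans_lt hε))).exists
    obtain ⟨s, hs, e, -, -, he, hle⟩ := hdom n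
    exact ⟨U n, hU n, e, n, hn, he, hle⟩
  · have h0 := hoc.hasAbsolutelyContinuousNorm U hU hanti (measure_iInter_tailSet D _)
    refine isWeaklyCompactOperator_of_approx fun ε hε => ?_
    obtain ⟨n, hn⟩ := (h0.eventually (gt_mem_nhds hε)).exists
    obtain ⟨W, hW, hWn⟩ := hup n
    exact ⟨W, hW, hWn ▸ hn.le⟩
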